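/- Let $\mathbb G$ be a (weak) 2-group, i.e. a monoidal groupoid $(\mathcal G,\otimes,I,a,l,r)$ in which, for every object $A$, the functors $A\otimes-$ and $-\otimes A$ are equivalences. Let $\pi_0=\pi_0(\mathbb G)$ be the group of isomorphism classes of objects and $\pi_1=\pi_1(\mathbb G)=\mathrm{Aut}(I)$, an abelian group. For an object $A$ let $\gamma_A,\delta_A:\pi_1\to\mathrm{Aut}(A)$ be the isomorphisms $\gamma_A(u)=l_A(u\otimes\mathrm{id}_A)l_A^{-1}$ and $\delta_A(u)=r_A(\mathrm{id}_A\otimes u)r_A^{-1}$; $\pi_0$ acts on $\pi_1$ by $[A]\cdot u=\gamma_A^{-1}(\delta_A(u))$. Choose representatives $A_g\in g$ for $g\in\pi_0$, with $A_e=I$, and isomorphisms $\mu_{g,h}:A_g\otimes A_h\to A_{gh}$ with $\mu_{e,g}=l_{A_g}$ and $\mu_{g,e}=r_{A_g}$. The corresponding classifying 3-cocycle $\alpha\in Z^3(\pi_0,\pi_1)$ is defined by letting $\gamma_{A_{ghk}}(\alpha(g,h,k))$ be the composite $$A_{ghk}\xrightarrow{\mu_{gh,k}^{-1}}A_{gh}\otimes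 A_k\xrightarrow{\mu_{g,h}^{-1}\otimes\mathrm{id}}(A_g\otimes A_h)\otimes A_k\xrightarrow{a}A_g\otimes(A_h\otimes A_k)\xrightarrow{\mathrm{id}\otimes\mu_{h,k}}A_g\otimes A_{hk}\xrightarrow{\mu_{g,hk}}A_{ghk}.$$ The 2-category $\mathbf{2Mat}_{\mathbb C}$ of 2-matrices has as objects the natural numbers. A 1-morphism $n\to m$ is a pair $(\mathbf R,s)$ of an $m\times n$ matrix $\mathbf R$ over $\mathbb N$ and a gauge $s=(s_1,\dots,s_m)$, $s_i(\mathbf a)\in GL(\mathbf R(\mathbf a)_i)$ for $\mathbf a\in\mathbb N^n$, with $s_i(\mathbf e_j)=\mathbf I$. A 2-morphism $(\mathbf R,s)\Rightarrow(\mathbf R',s')$ is a matrix $\mathsf T$ whose entry $\mathsf T_{ij}$ is a complex $R'_{ij}\times R_{ij}$ matrix. Vertical composition is entrywise matrix product. The composite of 1-morphisms is $(\widetilde{\mathbf R},\widetilde s)\circ(\mathbf R,s)=(\widetilde{\mathbf R}\mathbf R,\widetilde s*s)$ with $$(\widetilde s*s)_k(\mathbf a)=\widetilde s_k(\mathbf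 R(\mathbf a))\Big(\bigoplus_i\mathbf I_{\widetilde R_{ki}}\otimes s_i(\mathbf a)\Big)\mathbf P(\widetilde{\mathbf R}_k,\mathbf R,\mathbf a)\Big(\bigoplus_j\widetilde s_k(\mathbf R(\mathbf e_j))^{-1}\otimes\mathbf I_{a_j}\Big),$$ where $\mathbf P(\widetilde{\mathbf R}_k,\mathbf R,\mathbf a)$ is the permutation matrix of the canonical bijection between the lexicographically ordered bases of $\bigoplus_j(\bigoplus_i\mathbb C^{\widetilde R_{ki}}\otimes\mathbb C^{R_{ij}})\otimes\mathbb C^{a_j}$ and $\bigoplus_i\mathbb C^{\widetilde R_{ki}}\otimes(\bigoplus_j\mathbb C^{R_{ij}}\otimes\mathbb C^{a_j})$. Horizontal composition is $$(\widetilde{\mathsf T}\circ\mathsf T)_{kj}=\widetilde s'_k(\mathbf R'(\mathbf e_j))\Big(\bigoplus_i\widetilde{\mathsf T}_{ki}\otimes\mathsf T_{ij}\Big)\widetilde s_k(\mathbf R(\mathbf e_j))^{-1}.$$ A (2-matrix) representation of $\mathbb G$ is a pseudofunctor $F$ to $\mathbf{2Mat}_{\mathbb C}$ from the one-object bicategory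 of $\mathbb G$ (whose 1-morphisms are the objects of $\mathbb G$, with $A\circ B=A\otimes B$). Its dimension is the image of the unique object, and it is nonzero if its dimension is at least $1$. Two representations are isomorphic if there is a strictly invertible pseudonatural transformation between them. Let $S_n$ act on $(\mathbb C^*)^n$ by $(\sigma\cdot x)_i=x_{\sigma^{-1}(i)}$; for a homomorphism $\rho:\pi_0\to S_n$ write $(\mathbb C^*)^n_\rho$ for the resulting $\pi_0$-module. For $\alpha$ as above, consider the quadruples $(n,\rho,\beta,c)$ with $n\ge1$, $\rho:\pi_0\to S_n$ a group homomorphism, $\beta:\pi_1\to(\mathbb C^*)^n_\rho$ a homomorphism of $\pi_0$-modules such that $[\beta\circ\alpha]=0$ in $H^3(\pi_0,(\mathbb C^*)^n_\rho)$, and $c:\pi_0\times\pi_0\to(\mathbb C^*)^n_\rho$ a normalized 2-cochain with $\partial c=\beta\circ\alpha$, where $(\partial c)(g,h,k)=(g\cdot c(h,k))\,c(gh,k)^{-1}\,c(g,hk)\,c(g,h)^{-1}$. A representation $F_0$ of dimension $n$ is called a gauge trivial representation of the quadruple $(n,\rho,\beta,c)$ if - $F_0(A_g)=(\mathbf P(\rho(g)),\mathbf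 I)$ for all $g$, where $\mathbf P(\sigma)_{ij}=\delta_{i,\sigma(j)}$ and $\mathbf I$ is the trivial gauge; - $F_0(\gamma_{A_g}(u))_{\rho(g)(j),j}=\beta(u)_{\rho(g)(j)}$ for all $g\in\pi_0$, $u\in\pi_1$ and $j$; - the composite $F_0(A_g)\circ F_0(A_h)\Rightarrow F_0(A_g\otimes A_h)\Rightarrow F_0(A_{gh})$ of the structural 2-isomorphism with $F_0(\mu_{g,h})$ has $(\rho(gh)(j),j)$ entry $c(g,h)_{\rho(gh)(j)}$ for all $g,h$ and $j$; - the structural 2-isomorphism $\mathrm{id}_n\Rightarrow F_0(I)$ is the identity. **Theorem.** Let $\alpha$ be a classifying 3-cocycle of $\mathbb G$, and let representatives $A_g$ and isomorphisms $\mu_{g,h}$ computing it be fixed. Then: 1. every nonzero representation of $\mathbb G$, of dimension $n$ say, is isomorphic to a gauge trivial representation of some quadruple $(n,\rho,\beta,c)$; 2. for every quadruple $(n,\rho,\beta,c)$ there is a (nonzero) gauge trivial representation of it; 3. any two gauge trivial representations of the same quadruple are isomorphic. -/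

import Mathlib

open CategoryTheory MonoidalCategory
open scoped Kronecker

namespace TwoMatrix

/-- The lexicographic numbering of the basis of `⨁ j, ℂ ^ r j ⊗ ℂ ^ t j`. -/
def flat {m : ℕ} (r t : Fin m → ℕ) : (Σ j, Fin (r j) × Fin (t j)) ≃ Fin (∑ j, r j * t j) :=
  (Equiv.sigmaCongrRight fun _ => finProdFinEquiv).trans finSigmaFinEquiv

/-- The block sum of Kronecker products `⨁ j, T j ⊗ U j`; blocks with no rows or no columns are
allowed. -/
noncomputable def sumKron {m : ℕ} {r r' t t' : Fin m → ℕ}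
    (T : ∀ j, Matrix (Fin (r' j)) (Fin (r j)) ℂ) (U : ∀ j, Matrix (Fin (t' j)) (Fin (t j)) ℂ) :
    Matrix (Fin (∑ j, r' j * t' j)) (Fin (∑ j, r j * t j)) ℂ :=
  Matrix.reindex (flat r' t') (flat r t) (Matrix.blockDiagonal' fun j => T j ⊗ₖ U j)

theorem sumKron_mul {m : ℕ} {r r' r'' t t' t'' : Fin m → ℕ}
    (T' : ∀ j, Matrix (Fin (r'' j)) (Fin (r' j)) ℂ)
    (U' : ∀ j, Matrix (Fin (t'' j)) (Fin (t' j)) ℂ)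
    (T : ∀ j, Matrix (Fin (r' j)) (Fin (r j)) ℂ) (U : ∀ j, Matrix (Fin (t' j)) (Fin (t j)) ℂ) :
    sumKron T' U' * sumKron T U = sumKron (fun j => T' j * T j) (fun j => U' j * U j) := by
  simp only [sumKron, Matrix.reindex_apply, Matrix.submatrix_mul_equiv,
    ← Matrix.blockDiagonal'_mul, Matrix.mul_kronecker_mul]

theorem sumKron_one {m : ℕ} (r t : Fin m → ℕ) :
    sumKron (fun j => (1 : Matrix (Fin (r j)) (Fin (r j)) ℂ))
      (fun j => (1 : Matrix (Fin (t j)) (Fin (t j)) ℂ)) = 1 := by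
  simp only [sumKron, Matrix.one_kronecker_one]
  rw [show (fun j => (1 : Matrix (Fin (r j) × Fin (t j)) (Fin (r j) × Fin (t j)) ℂ)) = 1 from rfl,
    Matrix.blockDiagonal'_one]
  simp

theorem sumKron_apply_eq {m : ℕ} {r r' t t' : Fin m → ℕ}
    (T : ∀ j, Matrix (Fin (r' j)) (Fin (r j)) ℂ) (U : ∀ j, Matrix (Fin (t' j)) (Fin (t j)) ℂ)
    (j : Fin m) (p : Fin (r' j)) (q : Fin (t' j)) (p' : Fin (r j)) (q' : Fin (t j)) :
    sumKron T U (flat r' t' ⟨j, p, q⟩) (flat r t ⟨j, p', q'⟩) = T j p p' * U j q q' := by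
  simp [sumKron, Matrix.blockDiagonal'_apply_eq]

theorem sumKron_apply_ne {m : ℕ} {r r' t t' : Fin m → ℕ}
    (T : ∀ j, Matrix (Fin (r' j)) (Fin (r j)) ℂ) (U : ∀ j, Matrix (Fin (t' j)) (Fin (t j)) ℂ)
    {j j' : Fin m} (h : j ≠ j') (x : Fin (r' j) × Fin (t' j)) (y : Fin (r j') × Fin (t j')) :
    sumKron T U (flat r' t' ⟨j, x⟩) (flat r t ⟨j', y⟩) = 0 := by
  simp [sumKron, Matrix.blockDiagonal'_apply_ne _ _ _ h]

/-- The canonical bijection between the bases of `⨁ i, ℂ ^ r i ⊗ (⨁ j, ℂ ^ R i j ⊗ ℂ ^ a j)` and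
`⨁ j, (⨁ i, ℂ ^ r i ⊗ ℂ ^ R i j) ⊗ ℂ ^ a j`. -/
def shuffle {m n : ℕ} (r : Fin m → ℕ) (R : Fin m → Fin n → ℕ) (a : Fin n → ℕ) :
    Fin (∑ i, r i * ∑ j, R i j * a j) ≃ Fin (∑ j, (∑ i, r i * R i j) * a j) :=
  calc Fin (∑ i, r i * ∑ j, R i j * a j)
    _ ≃ (Σ i, Fin (r i) × Fin (∑ j, R i j * a j)) := (flat _ _).symm
    _ ≃ (Σ i, Fin (r i) × Σ j, Fin (R i j) × Fin (a j)) :=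
        Equiv.sigmaCongrRight fun i => Equiv.prodCongrRight fun _ => (flat (R i) a).symm
    _ ≃ (Σ j, (Σ i, Fin (r i) × Fin (R i j)) × Fin (a j)) :=
        { toFun := fun x => ⟨x.2.2.1, ⟨x.1, x.2.1, x.2.2.2.1⟩, x.2.2.2.2⟩
          invFun := fun x => ⟨x.2.1.1, x.2.1.2.1, x.1, x.2.1.2.2, x.2.2⟩
          left_inv := fun _ => rfl
          right_inv := fun _ => rfl }
    _ ≃ (Σ j, Fin (∑ i, r i * R i j) × Fin (a j)) :=
        Equiv.sigmaCongrRight fun j => Equiv.prodCongrLeft fun _ => flat r (fun i => R i j)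
    _ ≃ Fin (∑ j, (∑ i, r i * R i j) * a j) := flat _ _

theorem shuffle_flat {m n : ℕ} (r : Fin m → ℕ) (R : Fin m → Fin n → ℕ) (a : Fin n → ℕ)
    (i : Fin m) (j : Fin n) (p : Fin (r i)) (q : Fin (R i j)) (x : Fin (a j)) :
    shuffle r R a (flat _ _ ⟨i, p, flat _ _ ⟨j, q, x⟩⟩) =
      flat _ _ ⟨j, flat r (fun i => R i j) ⟨i, p, q⟩, x⟩ := by
  simp [shuffle, Trans.trans]

theorem sumKron_assoc {m n : ℕ} {r r' : Fin m → ℕ} {R R' : Fin m → Fin n → ℕ} {a a' : Fin n → ℕ}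
    (A : ∀ i, Matrix (Fin (r' i)) (Fin (r i)) ℂ)
    (B : ∀ i j, Matrix (Fin (R' i j)) (Fin (R i j)) ℂ)
    (C : ∀ j, Matrix (Fin (a' j)) (Fin (a j)) ℂ) :
    sumKron A (fun i => sumKron (B i) C) =
      (sumKron (fun j => sumKron A (fun i => B i j)) C).submatrix
        (shuffle r' R' a') (shuffle r R a) := by
  ext u v
  obtain ⟨⟨i, p, u⟩, rfl⟩ := (flat _ _).surjective u
  obtain ⟨⟨j, q, x⟩, rfl⟩ := (flat _ _).surjective u
  obtain ⟨⟨i', p', v⟩, rfl⟩ := (flat _ _).surjective v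
  obtain ⟨⟨j', q', x'⟩, rfl⟩ := (flat _ _).surjective v
  rw [Matrix.submatrix_apply, shuffle_flat, shuffle_flat]
  by_cases hi : i = i'
  · subst hi
    rw [sumKron_apply_eq]
    by_cases hj : j = j'
    · subst hj
      rw [sumKron_apply_eq, sumKron_apply_eq, sumKron_apply_eq]; ring
    · rw [sumKron_apply_ne _ _ hj, sumKron_apply_ne _ _ hj]; simp
  · rw [sumKron_apply_ne _ _ hi]
    by_cases hj : j = j'
    · subst hj
      rw [sumKron_apply_eq, sumKron_apply_ne _ _ hi]; simp
    · rw [sumKron_apply_ne _ _ hj]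

theorem shuffle_size {m n : ℕ} (r : Fin m → ℕ) (R : Fin m → Fin n → ℕ) (a : Fin n → ℕ) :
    ∑ i, r i * ∑ j, R i j * a j = ∑ j, (∑ i, r i * R i j) * a j := by
  simp only [Finset.mul_sum, Finset.sum_mul, mul_assoc]
  exact Finset.sum_comm

/-- The identity matrix, with rows and columns indexed by two names of the same number. -/
def idMat {a b : ℕ} (_h : a = b) : Matrix (Fin a) (Fin b) ℂ :=
  fun p q => if p.val = q.val then 1 else 0

/-- The permutation matrix from the basis of `⨁ j, (⨁ i, ℂ ^ r i ⊗ ℂ ^ R i j) ⊗ ℂ ^ a j` to that of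
`⨁ i, ℂ ^ r i ⊗ (⨁ j, ℂ ^ R i j ⊗ ℂ ^ a j)`. -/
def shuffleMat {m n : ℕ} (r : Fin m → ℕ) (R : Fin m → Fin n → ℕ) (a : Fin n → ℕ) :
    Matrix (Fin (∑ i, r i * ∑ j, R i j * a j)) (Fin (∑ j, (∑ i, r i * R i j) * a j)) ℂ :=
  (1 : Matrix _ _ ℂ).submatrix (shuffle r R a) id

theorem idMat_self {a : ℕ} (h : a = a) : idMat h = 1 := by
  ext p q; simp [idMat, Matrix.one_apply, Fin.ext_iff]

theorem idMat_mul_idMat {a b c : ℕ} (h : a = b) (h' : b = c) :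
    idMat h * idMat h' = idMat (h.trans h') := by
  subst h h'; simp [idMat_self]

theorem idMat_conj_apply {a b c d : ℕ} (h : a = b) (h' : c = d) (M : Matrix (Fin b) (Fin c) ℂ)
    (p : Fin a) (q : Fin d) : (idMat h * M * idMat h') p q = M (p.cast h) (q.cast h'.symm) := by
  subst h h'; simp [idMat_self]

theorem idMat_conj_heq {a b c d : ℕ} (h : a = b) (M : Matrix (Fin b) (Fin c) ℂ) (h' : c = d) :
    HEq (idMat h * M * idMat h') M := by
  subst h h'; simp [idMat_self]

theorem shuffleMat_mul_transpose {m n : ℕ} (r : Fin m → ℕ) (R : Fin m → Fin n → ℕ)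
    (a : Fin n → ℕ) : shuffleMat r R a * (shuffleMat r R a).transpose = 1 := by
  rw [shuffleMat, Matrix.transpose_submatrix, Matrix.transpose_one]
  rw [← Matrix.submatrix_mul _ _ _ _ _ Function.bijective_id]
  simp

theorem shuffleMat_transpose_mul {m n : ℕ} (r : Fin m → ℕ) (R : Fin m → Fin n → ℕ)
    (a : Fin n → ℕ) : (shuffleMat r R a).transpose * shuffleMat r R a = 1 := by
  rw [shuffleMat, Matrix.transpose_submatrix, Matrix.transpose_one]
  rw [← Matrix.submatrix_mul _ _ _ _ _ (shuffle r R a).bijective]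
  simp

theorem sumKron_shuffleMat {m n : ℕ} {r r' : Fin m → ℕ} {R R' : Fin m → Fin n → ℕ}
    {a a' : Fin n → ℕ} (A : ∀ i, Matrix (Fin (r' i)) (Fin (r i)) ℂ)
    (B : ∀ i j, Matrix (Fin (R' i j)) (Fin (R i j)) ℂ)
    (C : ∀ j, Matrix (Fin (a' j)) (Fin (a j)) ℂ) :
    sumKron A (fun i => sumKron (B i) C) * shuffleMat r R a =
      shuffleMat r' R' a' * sumKron (fun j => sumKron A (fun i => B i j)) C := by
  rw [sumKron_assoc, shuffleMat, shuffleMat]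
  ext u v
  obtain ⟨v, rfl⟩ := (shuffle r R a).surjective v
  simp [Matrix.mul_apply, Matrix.one_apply, Matrix.submatrix_apply]

theorem flat_val {m : ℕ} (r t : Fin m → ℕ) (j : Fin m) (p : Fin (r j)) (q : Fin (t j)) :
    (flat r t ⟨j, p, q⟩ : ℕ) =
      ∑ k : Fin j.val, r (k.castLE j.2.le) * t (k.castLE j.2.le) + (p * t j + q) := by
  simp [flat, finSigmaFinEquiv_apply, finProdFinEquiv]; ring

theorem flat_val_single_right {m : ℕ} (r : Fin m → ℕ) (i j : Fin m) (p : Fin (r j))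
    (q : Fin ((Pi.single i 1 : Fin m → ℕ) j)) :
    j = i ∧ (flat r (Pi.single i 1) ⟨j, p, q⟩ : ℕ) = p := by
  have hj : j = i := by
    by_contra h
    have := q.2
    simp [h] at this
  refine ⟨hj, ?_⟩
  subst hj
  have hq : (q : ℕ) = 0 := by have := q.2; simp at this; omega
  rw [flat_val, hq, Finset.sum_eq_zero]
  · simp
  · intro k _
    have : (k.castLE j.2.le) ≠ j := fun h => by
      have := congrArg Fin.val h; have := k.2; simp at *; omega
    simp [this]

theorem flat_val_single_left {m : ℕ} (t : Fin m → ℕ) (i j : Fin m)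
    (p : Fin ((Pi.single i 1 : Fin m → ℕ) j)) (q : Fin (t j)) :
    j = i ∧ (flat (Pi.single i 1) t ⟨j, p, q⟩ : ℕ) = q := by
  have hj : j = i := by
    by_contra h
    have := p.2
    simp [h] at this
  refine ⟨hj, ?_⟩
  subst hj
  have hp : (p : ℕ) = 0 := by have := p.2; simp at this; omega
  rw [flat_val, hp, Finset.sum_eq_zero]
  · simp
  · intro k _
    have : (k.castLE j.2.le) ≠ j := fun h => by
      have := congrArg Fin.val h; have := k.2; simp at *; omega
    simp [this]

theorem sum_single_right {m : ℕ} (r : Fin m → ℕ) (i : Fin m) :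
    ∑ j, r j * (Pi.single i 1 : Fin m → ℕ) j = r i := by
  simp [Pi.single_apply]

theorem sum_single_left {m : ℕ} (t : Fin m → ℕ) (i : Fin m) :
    ∑ j, (Pi.single i 1 : Fin m → ℕ) j * t j = t i := by
  simp [Pi.single_apply]

theorem sumKron_single_right {m : ℕ} {r r' : Fin m → ℕ} (i : Fin m)
    (T : ∀ j, Matrix (Fin (r' j)) (Fin (r j)) ℂ) :
    sumKron T (fun j => (1 : Matrix (Fin ((Pi.single i 1 : Fin m → ℕ) j)) _ ℂ)) =
      idMat (sum_single_right r' i) * T i * idMat (sum_single_right r i).symm := by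
  ext u v
  rw [idMat_conj_apply]
  obtain ⟨⟨j, p, q⟩, rfl⟩ := (flat _ _).surjective u
  obtain ⟨⟨j', p', q'⟩, rfl⟩ := (flat _ _).surjective v
  obtain ⟨rfl, h⟩ := flat_val_single_right r' i j p q
  obtain ⟨hj, h'⟩ := flat_val_single_right r j j' p' q'
  subst hj
  have hq : q = q' := by
    ext; have := q.2; have := q'.2; simp at *; omega
  subst hq
  rw [sumKron_apply_eq, Matrix.one_apply_eq, mul_one]
  congr 1 <;> ext
  · exact h.symm
  · exact h'.symm

theorem sumKron_single_left {m : ℕ} {t t' : Fin m → ℕ} (i : Fin m)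
    (U : ∀ j, Matrix (Fin (t' j)) (Fin (t j)) ℂ) :
    sumKron (fun j => (1 : Matrix (Fin ((Pi.single i 1 : Fin m → ℕ) j)) _ ℂ)) U =
      idMat (sum_single_left t' i) * U i * idMat (sum_single_left t i).symm := by
  ext u v
  rw [idMat_conj_apply]
  obtain ⟨⟨j, p, q⟩, rfl⟩ := (flat _ _).surjective u
  obtain ⟨⟨j', p', q'⟩, rfl⟩ := (flat _ _).surjective v
  obtain ⟨rfl, h⟩ := flat_val_single_left t' i j p q
  obtain ⟨hj, h'⟩ := flat_val_single_left t j j' p' q'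
  subst hj
  have hq : p = p' := by
    ext; have := p.2; have := p'.2; simp at *; omega
  subst hq
  rw [sumKron_apply_eq, Matrix.one_apply_eq, one_mul]
  congr 1 <;> ext
  · exact h.symm
  · exact h'.symm

theorem flat_val_congr {m : ℕ} {r t t' : Fin m → ℕ} (h : t = t') (j : Fin m) (p : Fin (r j))
    (q : Fin (t j)) (q' : Fin (t' j)) (hq : q.val = q'.val) :
    (flat r t ⟨j, p, q⟩ : ℕ) = flat r t' ⟨j, p, q'⟩ := by
  subst h; rw [Fin.ext hq]

theorem shuffleMat_single {m n : ℕ} (r : Fin m → ℕ) (R : Fin m → Fin n → ℕ) (i : Fin n) :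
    shuffleMat r R (Pi.single i 1) = idMat (shuffle_size r R _) := by
  ext u v
  obtain ⟨⟨k, p, u⟩, rfl⟩ := (flat _ _).surjective u
  obtain ⟨⟨j, q, x⟩, rfl⟩ := (flat _ _).surjective u
  rw [shuffleMat, Matrix.submatrix_apply, shuffle_flat, Matrix.one_apply, idMat, id]
  have h1 := flat_val_single_right (R k) i j q x
  have h2 := flat_val_single_right (fun j => ∑ i, r i * R i j) i j
    (flat r (fun i => R i j) ⟨k, p, q⟩) x
  obtain ⟨rfl, h1⟩ := h1
  have h3 : (flat r (fun j_1 => ∑ j_2, R j_1 j_2 * (Pi.single j 1 : Fin n → ℕ) j_2)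
      ⟨k, p, flat (R k) (Pi.single j 1) ⟨j, q, x⟩⟩ : ℕ) = flat r (fun i => R i j) ⟨k, p, q⟩ :=
    flat_val_congr (funext fun k => sum_single_right _ _) k p _ q h1
  simp only [Fin.ext_iff, h2.2, h3]

theorem mul_cancel_left {a b c : ℕ} {A : Matrix (Fin a) (Fin b) ℂ} {B : Matrix (Fin b) (Fin a) ℂ}
    (h : A * B = 1) (M : Matrix (Fin a) (Fin c) ℂ) : A * (B * M) = M := by
  rw [← Matrix.mul_assoc, h, Matrix.one_mul]

theorem conj_mul {a b c a' b' c' : ℕ} (A : Matrix (Fin a) (Fin a') ℂ)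
    (M' : Matrix (Fin a') (Fin b') ℂ) (M : Matrix (Fin b') (Fin c') ℂ)
    (C : Matrix (Fin c') (Fin c) ℂ) {B' : Matrix (Fin b') (Fin b) ℂ}
    {B : Matrix (Fin b) (Fin b') ℂ} (h : B' * B = 1) :
    A * (M' * M) * C = (A * M' * B') * (B * M * C) := by
  simp only [Matrix.mul_assoc]
  rw [mul_cancel_left h]

/-- The family of identity matrices of sizes `r j`. -/
def ones {m : ℕ} (r : Fin m → ℕ) (j : Fin m) : Matrix (Fin (r j)) (Fin (r j)) ℂ := 1

theorem sumKron_ones {m : ℕ} (r t : Fin m → ℕ) : sumKron (ones r) (ones t) = 1 := sumKron_one r t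

theorem sumKron_eq_one {m : ℕ} {r t : Fin m → ℕ} {T : ∀ j, Matrix (Fin (r j)) (Fin (r j)) ℂ}
    {U : ∀ j, Matrix (Fin (t j)) (Fin (t j)) ℂ} (hT : ∀ j, T j = 1) (hU : ∀ j, U j = 1) :
    sumKron T U = 1 := by
  rw [show T = ones r from funext hT, show U = ones t from funext hU, sumKron_ones]

/-- A 1-morphism `n ⟶ m` of 2-matrices: a rank matrix together with a normalized gauge. The size of
`gauge i a` is the `i`-th entry of the product of the rank matrix with the column `a`. -/
@[ext]
structure Mor (n m : ℕ) where
  rank : Fin m → Fin n → ℕ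
  gauge : ∀ (i : Fin m) (a : Fin n → ℕ), GL (Fin (∑ j, rank i j * a j)) ℂ
  gauge_single : ∀ i j, gauge i (Pi.single j 1) = 1

namespace Mor

theorem gauge_congr {n m : ℕ} (F : Mor n m) (i : Fin m) {a b : Fin n → ℕ} (h : a = b) :
    (F.gauge i a).val = idMat (congrArg (fun a => ∑ j, F.rank i j * a j) h) *
      (F.gauge i b).val * idMat (congrArg (fun a => ∑ j, F.rank i j * a j) h.symm) := by
  subst h; simp [idMat_self]

theorem gauge_mul_inv {n m : ℕ} (F : Mor n m) (i : Fin m) (a : Fin n → ℕ) :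
    (F.gauge i a).val * (F.gauge i a)⁻¹.val = 1 := Units.mul_inv _

theorem gauge_inv_mul {n m : ℕ} (F : Mor n m) (i : Fin m) (a : Fin n → ℕ) :
    (F.gauge i a)⁻¹.val * (F.gauge i a).val = 1 := Units.inv_mul _

/-- The gauge of a composite. -/
noncomputable def compGauge {n m l : ℕ} (G : Mor m l) (F : Mor n m) (k : Fin l) (a : Fin n → ℕ) :
    GL (Fin (∑ j, (∑ i, G.rank k i * F.rank i j) * a j)) ℂ where
  val := idMat (shuffle_size (G.rank k) F.rank a).symm *
    (G.gauge k (fun i => ∑ j, F.rank i j * a j)).val *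
    sumKron (ones (G.rank k)) (fun i => (F.gauge i a).val) *
    shuffleMat (G.rank k) F.rank a *
    sumKron (fun j => (G.gauge k (fun i => F.rank i j))⁻¹.val) (ones a)
  inv :=
    sumKron (fun j => (G.gauge k (fun i => F.rank i j)).val) (ones a) *
    (shuffleMat (G.rank k) F.rank a).transpose *
    sumKron (ones (G.rank k)) (fun i => (F.gauge i a)⁻¹.val) *
    (G.gauge k (fun i => ∑ j, F.rank i j * a j))⁻¹.val *
    idMat (shuffle_size (G.rank k) F.rank a)
  val_inv := by
    simp only [Matrix.mul_assoc]
    rw [mul_cancel_left (A := sumKron (fun j => (G.gauge k (fun i => F.rank i j))⁻¹.val) (ones a))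
        (by rw [sumKron_mul]
            exact sumKron_eq_one (fun j => gauge_inv_mul _ _ _) fun j => Matrix.mul_one _),
      mul_cancel_left (shuffleMat_mul_transpose _ _ _),
      mul_cancel_left (A := sumKron (ones (G.rank k)) (fun i => (F.gauge i a).val))
        (by rw [sumKron_mul]
            exact sumKron_eq_one (fun j => Matrix.mul_one _) fun j => gauge_mul_inv _ _ _),
      mul_cancel_left (gauge_mul_inv _ _ _), idMat_mul_idMat, idMat_self]
  inv_val := by
    simp only [Matrix.mul_assoc]
    rw [mul_cancel_left (A := idMat _) (by rw [idMat_mul_idMat, idMat_self]),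
      mul_cancel_left (gauge_inv_mul _ _ _),
      mul_cancel_left (A := sumKron (ones (G.rank k)) (fun i => (F.gauge i a)⁻¹.val))
        (by rw [sumKron_mul]
            exact sumKron_eq_one (fun j => Matrix.mul_one _) fun j => gauge_inv_mul _ _ _),
      mul_cancel_left (shuffleMat_transpose_mul _ _ _), sumKron_mul]
    exact sumKron_eq_one (fun j => gauge_mul_inv _ _ _) fun j => Matrix.mul_one _

/-- Composition of 1-morphisms, written in the order of the composition of maps. -/
noncomputable def comp {n m l : ℕ} (G : Mor m l) (F : Mor n m) : Mor n l where
  rank k j := ∑ i, G.rank k i * F.rank i j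
  gauge := compGauge G F
  gauge_single k j := by
    apply Units.ext
    have h : (fun i => ∑ j', F.rank i j' * (Pi.single j 1 : Fin n → ℕ) j') =
      fun i => F.rank i j := funext fun i => sum_single_right _ _
    have hs : sumKron (ones (G.rank k)) (fun i => (F.gauge i (Pi.single j 1)).val) = 1 :=
      sumKron_eq_one (fun _ => rfl) fun i => by rw [F.gauge_single]; rfl
    simp only [compGauge]
    rw [hs, shuffleMat_single, gauge_congr G k h]
    have hk := sumKron_single_right j (fun j => (G.gauge k (fun i => F.rank i j))⁻¹.val)
    change _ * sumKron (fun j => (G.gauge k (fun i => F.rank i j))⁻¹.val)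
      (fun j' => (1 : Matrix (Fin ((Pi.single j 1 : Fin n → ℕ) j')) _ ℂ)) = _
    rw [hk]
    simp only [Matrix.mul_assoc, Matrix.one_mul]
    rw [← Matrix.mul_assoc (idMat _) (idMat _) (idMat _ * _), idMat_mul_idMat]
    rw [mul_cancel_left (A := idMat _) (B := idMat _) (by rw [idMat_mul_idMat, idMat_self])]
    rw [mul_cancel_left (gauge_mul_inv _ _ _), ← Matrix.mul_assoc, idMat_mul_idMat,
      idMat_mul_idMat, idMat_self]
    rfl

/-- The identity 1-morphism. -/
def one (n : ℕ) : Mor n n where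
  rank i j := (Pi.single j 1 : Fin n → ℕ) i
  gauge _ _ := 1
  gauge_single _ _ := rfl

theorem size_congr {n m : ℕ} {F G : Mor n m} (h : F.rank = G.rank) (i : Fin m) (a : Fin n → ℕ) :
    ∑ j, F.rank i j * a j = ∑ j, G.rank i j * a j := by rw [h]

theorem size_congr' {m : ℕ} (r : Fin m → ℕ) {a b : Fin m → ℕ} (h : ∀ j, a j = b j) :
    ∑ j, r j * a j = ∑ j, r j * b j := by simp only [h]

/-- The action of a 1-morphism on a family of matrices. -/
noncomputable def onHom {n m : ℕ} (F : Mor n m) {a b : Fin n → ℕ}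
    (f : ∀ j, Matrix (Fin (b j)) (Fin (a j)) ℂ) (i : Fin m) :
    Matrix (Fin (∑ j, F.rank i j * b j)) (Fin (∑ j, F.rank i j * a j)) ℂ :=
  (F.gauge i b).val * sumKron (ones (F.rank i)) f * (F.gauge i a)⁻¹.val

theorem sandwich {n m l : ℕ} {G G' : Mor m l} {F F' : Mor n m} {a a' : Fin n → ℕ} (k : Fin l)
    (A : ∀ i, Matrix (Fin (G'.rank k i)) (Fin (G.rank k i)) ℂ)
    (B : ∀ i j, Matrix (Fin (F'.rank i j)) (Fin (F.rank i j)) ℂ)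
    (C : ∀ j, Matrix (Fin (a' j)) (Fin (a j)) ℂ) :
    (compGauge G' F' k a').val *
      sumKron (fun j => (G'.gauge k (fun i => F'.rank i j)).val * sumKron A (fun i => B i j) *
        (G.gauge k (fun i => F.rank i j))⁻¹.val) C * (compGauge G F k a)⁻¹.val =
    idMat (shuffle_size (G'.rank k) F'.rank a').symm *
      ((G'.gauge k (fun i => ∑ j, F'.rank i j * a' j)).val *
        sumKron A (fun i => (F'.gauge i a').val * sumKron (B i) C * (F.gauge i a)⁻¹.val) *
        (G.gauge k (fun i => ∑ j, F.rank i j * a j))⁻¹.val) *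
      idMat (shuffle_size (G.rank k) F.rank a) := by
  have h1 : sumKron (fun j => (G'.gauge k (fun i => F'.rank i j)).val *
      sumKron A (fun i => B i j) * (G.gauge k (fun i => F.rank i j))⁻¹.val) C =
      sumKron (fun j => (G'.gauge k (fun i => F'.rank i j)).val) (ones a') *
        (sumKron (fun j => sumKron A (fun i => B i j)) C *
        sumKron (fun j => (G.gauge k (fun i => F.rank i j))⁻¹.val) (ones a)) := by
    rw [sumKron_mul, sumKron_mul]
    congr 1
    · funext j; rw [Matrix.mul_assoc]
    · funext j; simp [ones]
  have h2 : sumKron A (fun i => (F'.gauge i a').val * sumKron (B i) C * (F.gauge i a)⁻¹.val) =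
      sumKron (ones (G'.rank k)) (fun i => (F'.gauge i a').val) *
        (sumKron A (fun i => sumKron (B i) C) *
        sumKron (ones (G.rank k)) (fun i => (F.gauge i a)⁻¹.val)) := by
    rw [sumKron_mul, sumKron_mul]
    congr 1
    · funext j; simp [ones]
    · funext j; rw [Matrix.mul_assoc]
  have h3 : sumKron A (fun i => sumKron (B i) C) = shuffleMat (G'.rank k) F'.rank a' *
      (sumKron (fun j => sumKron A (fun i => B i j)) C *
        (shuffleMat (G.rank k) F.rank a).transpose) := by
    rw [← Matrix.mul_assoc, ← sumKron_shuffleMat, Matrix.mul_assoc, shuffleMat_mul_transpose,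
      Matrix.mul_one]
  have hv : (compGauge G' F' k a').val =
      idMat (shuffle_size (G'.rank k) F'.rank a').symm *
      (G'.gauge k (fun i => ∑ j, F'.rank i j * a' j)).val *
      sumKron (ones (G'.rank k)) (fun i => (F'.gauge i a').val) *
      shuffleMat (G'.rank k) F'.rank a' *
      sumKron (fun j => (G'.gauge k (fun i => F'.rank i j))⁻¹.val) (ones a') := rfl
  have hi : (compGauge G F k a)⁻¹.val =
      sumKron (fun j => (G.gauge k (fun i => F.rank i j)).val) (ones a) *
      (shuffleMat (G.rank k) F.rank a).transpose *
      sumKron (ones (G.rank k)) (fun i => (F.gauge i a)⁻¹.val) *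
      (G.gauge k (fun i => ∑ j, F.rank i j * a j))⁻¹.val *
      idMat (shuffle_size (G.rank k) F.rank a) := rfl
  have c1 : sumKron (fun j => (G'.gauge k (fun i => F'.rank i j))⁻¹.val) (ones a') *
      sumKron (fun j => (G'.gauge k (fun i => F'.rank i j)).val) (ones a') = 1 := by
    rw [sumKron_mul]
    exact sumKron_eq_one (fun j => gauge_inv_mul _ _ _) fun j => Matrix.mul_one _
  have c2 : sumKron (fun j => (G.gauge k (fun i => F.rank i j))⁻¹.val) (ones a) *
      sumKron (fun j => (G.gauge k (fun i => F.rank i j)).val) (ones a) = 1 := by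
    rw [sumKron_mul]
    exact sumKron_eq_one (fun j => gauge_inv_mul _ _ _) fun j => Matrix.mul_one _
  rw [hv, hi, h1, h2, h3]
  simp only [Matrix.mul_assoc]
  erw [mul_cancel_left c1, mul_cancel_left c2]

theorem onHom_ones {n m : ℕ} (F : Mor n m) (a : Fin n → ℕ) (i : Fin m) :
    F.onHom (ones a) i = 1 := by
  rw [onHom, sumKron_ones, Matrix.mul_one, gauge_mul_inv]

theorem comp_onHom {n m l : ℕ} (G : Mor m l) (F : Mor n m) {a b : Fin n → ℕ}
    (f : ∀ j, Matrix (Fin (b j)) (Fin (a j)) ℂ) (k : Fin l) :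
    (comp G F).onHom f k = idMat (shuffle_size (G.rank k) F.rank b).symm *
      G.onHom (F.onHom f) k * idMat (shuffle_size (G.rank k) F.rank a) := by
  have := sandwich (G := G) (G' := G) (F := F) (F' := F) k (ones _) (fun i => ones _) f
  refine Eq.trans ?_ this
  have h : (fun j => (G.gauge k (fun i => F.rank i j)).val *
      sumKron (ones (G.rank k)) (fun i => ones (F.rank i) j) *
        (G.gauge k (fun i => F.rank i j))⁻¹.val) = ones ((comp G F).rank k) := by
    funext j
    exact onHom_ones G _ _
  rw [h]; rfl

theorem idMat_conj_idMat {a b c d e f : ℕ} (h1 : a = b) (h2 : b = c) (M : Matrix (Fin c) (Fin d) ℂ)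
    (h3 : d = e) (h4 : e = f) :
    idMat h1 * (idMat h2 * M * idMat h3) * idMat h4 =
      idMat (h1.trans h2) * M * idMat (h3.trans h4) := by
  subst h1 h2 h3 h4; simp [idMat_self]

theorem one_row {n : ℕ} (i : Fin n) :
    (fun j => (Pi.single j 1 : Fin n → ℕ) i) = Pi.single i 1 := by
  funext j; simp [Pi.single_apply, eq_comm]

theorem one_size {n : ℕ} (t : Fin n → ℕ) (i : Fin n) : ∑ j, (one n).rank i j * t j = t i := by
  simp [one, Pi.single_apply]

theorem one_onHom {n : ℕ} {a b : Fin n → ℕ}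
    (f : ∀ j, Matrix (Fin (b j)) (Fin (a j)) ℂ) (i : Fin n) :
    (one n).onHom f i = idMat (one_size b i) * f i * idMat (one_size a i).symm := by
  have hs : ∀ (t r : Fin n → ℕ), r = Pi.single i 1 → ∑ j, r j * t j = t i := by
    rintro t r rfl; exact sum_single_left t i
  have key : ∀ (r : Fin n → ℕ) (hr : r = Pi.single i 1), sumKron (ones r) f =
      idMat (hs b r hr) * f i * idMat (hs a r hr).symm := by
    intro r hr
    subst hr
    exact sumKron_single_left i f
  have : (one n).onHom f i = sumKron (ones ((one n).rank i)) f := by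
    simp only [onHom]
    erw [Units.val_one, inv_one, Units.val_one, Matrix.one_mul, Matrix.mul_one]
  rw [this]
  exact key _ (one_row i)

theorem onHom_idMat_conj {n m : ℕ} (F : Mor n m) {a a' b b' : Fin n → ℕ} (ha : ∀ j, a j = a' j)
    (hb : ∀ j, b' j = b j) (f : ∀ j, Matrix (Fin (b j)) (Fin (a j)) ℂ) (i : Fin m) :
    F.onHom (fun j => idMat (hb j) * f j * idMat (ha j)) i =
      idMat (size_congr' (F.rank i) hb) * F.onHom f i * idMat (size_congr' (F.rank i) ha) := by
  obtain rfl : a = a' := funext ha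
  obtain rfl : b' = b := funext hb
  simp [idMat_self]

/-- The inclusion of a basis vector. -/
def incl {n : ℕ} (a : Fin n → ℕ) (j : Fin n) (x : Fin (a j)) (j' : Fin n) :
    Matrix (Fin (a j')) (Fin ((Pi.single j 1 : Fin n → ℕ) j')) ℂ :=
  fun p _ => if p.val = x.val then 1 else 0

theorem onHom_incl {n m : ℕ} (F : Mor n m) (a : Fin n → ℕ) (i : Fin m) (j : Fin n)
    (x : Fin (a j)) (q : Fin (F.rank i j)) (z : Fin ((Pi.single j 1 : Fin n → ℕ) j))
    (u : Fin (∑ j, F.rank i j * a j)) :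
    F.onHom (incl a j x) i u (flat _ _ ⟨j, q, z⟩) = (F.gauge i a).val u (flat _ _ ⟨j, q, x⟩) := by
  rw [onHom, F.gauge_single, inv_one, Units.val_one, Matrix.mul_one, Matrix.mul_apply]
  rw [Finset.sum_eq_single (flat _ _ ⟨j, q, x⟩)]
  · rw [sumKron_apply_eq]; simp [ones, incl]
  · intro w _ hw
    obtain ⟨⟨j', q', x'⟩, rfl⟩ := (flat _ _).surjective w
    by_cases hj : j' = j
    · subst hj
      rw [sumKron_apply_eq]
      by_cases hq : q' = q
      · subst hq
        have : x'.val ≠ x.val := fun h => hw (by rw [Fin.ext h])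
        simp [incl, this]
      · simp [ones, hq]
    · rw [sumKron_apply_ne _ _ hj, mul_zero]
  · simp

theorem ext_onHom {n m : ℕ} {F G : Mor n m} (h : F.rank = G.rank)
    (hg : ∀ (a b : Fin n → ℕ) (f : ∀ j, Matrix (Fin (b j)) (Fin (a j)) ℂ) (i : Fin m),
      F.onHom f i = idMat (size_congr h i b) * G.onHom f i * idMat (size_congr h i a).symm) : F = G := by
  obtain ⟨R, s, hs⟩ := F
  obtain ⟨R', s', hs'⟩ := G
  obtain rfl : R = R' := h
  congr 1
  funext i a
  apply Units.ext
  ext u v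
  obtain ⟨⟨j, q, x⟩, rfl⟩ := (flat _ _).surjective v
  have h1 := onHom_incl ⟨R, s, hs⟩ a i j x q ⟨0, by simp⟩ u
  have h2 := onHom_incl ⟨R, s', hs'⟩ a i j x q ⟨0, by simp⟩ u
  have h3 := hg _ _ (incl a j x) i
  simp only [idMat_self, Matrix.one_mul, Matrix.mul_one] at h3
  rw [← h1, ← h2, h3]

theorem comp_one {n m : ℕ} (F : Mor n m) : comp F (one n) = F := by
  refine ext_onHom ?_ fun a b f i => ?_
  · funext i j
    exact sum_single_right _ _
  · rw [comp_onHom, show (one n).onHom f = fun j => idMat (one_size b j) * f j *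
      idMat (one_size a j).symm from funext fun j => one_onHom f j, onHom_idMat_conj,
      idMat_conj_idMat]
    rfl

theorem one_comp {n m : ℕ} (F : Mor n m) : comp (one m) F = F := by
  refine ext_onHom ?_ fun a b f i => ?_
  · funext i j
    exact one_size (fun i => F.rank i j) i
  · rw [comp_onHom, one_onHom, idMat_conj_idMat]
    rfl

theorem comp_assoc {n m l k : ℕ} (H : Mor l k) (G : Mor m l) (F : Mor n m) :
    comp H (comp G F) = comp (comp H G) F := by
  refine ext_onHom ?_ fun a b f i => ?_
  · funext i j
    exact shuffle_size (H.rank i) G.rank (fun i => F.rank i j)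
  · have e : H.onHom ((comp G F).onHom f) i = _ :=
      (congrArg (fun φ => H.onHom φ i) (funext fun j => comp_onHom G F f j)).trans
        (onHom_idMat_conj H (fun j => shuffle_size (G.rank j) F.rank a)
          (fun j => (shuffle_size (G.rank j) F.rank b).symm) (G.onHom (F.onHom f)) i)
    rw [comp_onHom, comp_onHom, comp_onHom]
    refine (congrArg (fun M => idMat _ * M * idMat _) e).trans ?_
    refine eq_of_heq ((idMat_conj_heq _ _ _).trans ((idMat_conj_heq _ _ _).trans ?_))
    exact ((idMat_conj_heq _ _ _).trans ((idMat_conj_heq _ _ _).trans (idMat_conj_heq _ _ _))).symm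

end Mor

/-- A 2-morphism between 1-morphisms `n ⟶ m` of 2-matrices: a matrix of complex matrices. An entry
with no rows or no columns is the empty matrix. -/
@[ext]
structure Mor2 {n m : ℕ} (F G : Mor n m) where
  entry : ∀ i j, Matrix (Fin (G.rank i j)) (Fin (F.rank i j)) ℂ

instance (n m : ℕ) : Category (Mor n m) where
  Hom F G := Mor2 F G
  id F := ⟨fun _ _ => 1⟩
  comp S T := ⟨fun i j => T.entry i j * S.entry i j⟩
  id_comp _ := by ext : 1; simp
  comp_id _ := by ext : 1; simp
  assoc _ _ _ := by ext : 1; simp [Matrix.mul_assoc]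

namespace Mor2

theorem hom_ext {n m : ℕ} {F G : Mor n m} {S T : F ⟶ G}
    (h : ∀ i j, S.entry i j = T.entry i j) : S = T :=
  Mor2.ext (funext fun i => funext fun j => h i j)

/-- Horizontal composition of 2-morphisms, written in the order of the composition of maps. -/
noncomputable def hcomp {n m l : ℕ} {G G' : Mor m l} {F F' : Mor n m} (S : G ⟶ G') (T : F ⟶ F') :
    Mor.comp G F ⟶ Mor.comp G' F' where
  entry k j := (G'.gauge k (fun i => F'.rank i j)).val *
    sumKron (fun i => S.entry k i) (fun i => T.entry i j) *
    (G.gauge k (fun i => F.rank i j))⁻¹.val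

theorem hcomp_id {n m l : ℕ} (G : Mor m l) (F : Mor n m) :
    hcomp (𝟙 G) (𝟙 F) = 𝟙 (Mor.comp G F) :=
  hom_ext fun k _ => Mor.onHom_ones G _ k

theorem hcomp_comp {n m l : ℕ} {G G' G'' : Mor m l} {F F' F'' : Mor n m} (S : G ⟶ G')
    (S' : G' ⟶ G'') (T : F ⟶ F') (T' : F' ⟶ F'') :
    hcomp (S ≫ S') (T ≫ T') = hcomp S T ≫ hcomp S' T' := by
  refine hom_ext fun k j => ?_
  have := conj_mul (G''.gauge k (fun i => F''.rank i j)).val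
    (sumKron (fun i => S'.entry k i) (fun i => T'.entry i j))
    (sumKron (fun i => S.entry k i) (fun i => T.entry i j))
    (G.gauge k (fun i => F.rank i j))⁻¹.val (Mor.gauge_inv_mul G' k fun i => F'.rank i j)
  rw [sumKron_mul] at this
  exact this

theorem hcomp_one {n m : ℕ} {F F' : Mor n m} (T : F ⟶ F') (i : Fin m) (j : Fin n) :
    HEq ((hcomp T (𝟙 (Mor.one n))).entry i j) (T.entry i j) := by
  have h : (hcomp T (𝟙 (Mor.one n))).entry i j =
      sumKron (fun k => T.entry i k) (ones (Pi.single j 1)) := by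
    have h1 : (F'.gauge i (Pi.single j 1)).val = 1 := by rw [F'.gauge_single]; rfl
    have h2 : (F.gauge i (Pi.single j 1))⁻¹.val = 1 := by rw [F.gauge_single, inv_one]; rfl
    have : (F'.gauge i (Pi.single j 1)).val *
        sumKron (fun k => T.entry i k) (ones (Pi.single j 1 : Fin n → ℕ)) *
        (F.gauge i (Pi.single j 1))⁻¹.val =
        sumKron (fun k => T.entry i k) (ones (Pi.single j 1 : Fin n → ℕ)) := by
      rw [h1, h2, Matrix.one_mul, Matrix.mul_one]
    exact this
  rw [h]
  exact (heq_of_eq (sumKron_single_right j fun k => T.entry i k)).trans (idMat_conj_heq _ _ _)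

theorem one_hcomp {n m : ℕ} {F F' : Mor n m} (T : F ⟶ F') (i : Fin m) (j : Fin n) :
    HEq ((hcomp (𝟙 (Mor.one m)) T).entry i j) (T.entry i j) :=
  (heq_of_eq (Mor.one_onHom (fun i => T.entry i j) i)).trans (idMat_conj_heq _ _ _)

theorem hcomp_assoc {n m l o : ℕ} {H H' : Mor l o} {G G' : Mor m l} {F F' : Mor n m}
    (U : H ⟶ H') (S : G ⟶ G') (T : F ⟶ F') (k : Fin o) (j : Fin n) :
    HEq ((hcomp (hcomp U S) T).entry k j) ((hcomp U (hcomp S T)).entry k j) :=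
  (heq_of_eq (Mor.sandwich k (fun i => U.entry k i) S.entry fun i => T.entry i j)).trans
    (idMat_conj_heq _ _ _)

theorem eqToHom_conj_heq {n m : ℕ} {F F' G G' : Mor n m} (h : F = F') (T : F' ⟶ G') (h' : G' = G)
    (i : Fin m) (j : Fin n) :
    HEq ((eqToHom h ≫ T ≫ eqToHom h').entry i j) (T.entry i j) := by
  subst h h'; simp

theorem hcomp_eqToHom {n m l : ℕ} {G G' : Mor m l} {F F' : Mor n m} (h : G = G') (h' : F = F') :
    hcomp (eqToHom h) (eqToHom h') = eqToHom (by rw [h, h']) := by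
  subst h h'; exact hcomp_id G F

end Mor2

end TwoMatrix

/-- The objects of the 2-category of 2-matrices: natural numbers. -/
structure TwoMat where
  dim : ℕ

namespace TwoMat

open TwoMatrix

noncomputable instance : Bicategory TwoMat where
  Hom X Y := Mor X.dim Y.dim
  id X := Mor.one X.dim
  comp F G := Mor.comp G F
  whiskerLeft F _ _ T := Mor2.hcomp T (𝟙 F)
  whiskerRight T G := Mor2.hcomp (𝟙 G) T
  associator F G H := eqToIso (Mor.comp_assoc H G F)
  leftUnitor F := eqToIso (Mor.comp_one F)
  rightUnitor F := eqToIso (Mor.one_comp F)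
  whiskerLeft_id F G := Mor2.hcomp_id G F
  whiskerLeft_comp F _ _ _ S T := by
    rw [← Mor2.hcomp_comp, Category.comp_id]
  id_whiskerRight F G := Mor2.hcomp_id G F
  comp_whiskerRight S T G := by
    rw [← Mor2.hcomp_comp, Category.comp_id]
  whisker_exchange S T := by
    rw [← Mor2.hcomp_comp, ← Mor2.hcomp_comp]; simp
  id_whiskerLeft T := by
    simp only [eqToIso.hom, eqToIso.inv]
    exact Mor2.hom_ext fun i j => eq_of_heq
      ((Mor2.hcomp_one T i j).trans (Mor2.eqToHom_conj_heq _ _ _ i j).symm)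
  whiskerRight_id T := by
    simp only [eqToIso.hom, eqToIso.inv]
    exact Mor2.hom_ext fun i j => eq_of_heq
      ((Mor2.one_hcomp T i j).trans (Mor2.eqToHom_conj_heq _ _ _ i j).symm)
  comp_whiskerLeft F G _ _ T := by
    rw [← Mor2.hcomp_id]
    simp only [eqToIso.hom, eqToIso.inv]
    exact Mor2.hom_ext fun i j => eq_of_heq
      ((Mor2.hcomp_assoc T (𝟙 G) (𝟙 F) i j).symm.trans (Mor2.eqToHom_conj_heq _ _ _ i j).symm)
  whiskerRight_comp T G H := by
    rw [← Mor2.hcomp_id]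
    simp only [eqToIso.hom, eqToIso.inv]
    exact Mor2.hom_ext fun i j => eq_of_heq
      ((Mor2.hcomp_assoc (𝟙 H) (𝟙 G) T i j).trans (Mor2.eqToHom_conj_heq _ _ _ i j).symm)
  whisker_assoc F _ _ T H := by
    simp only [eqToIso.hom, eqToIso.inv]
    exact Mor2.hom_ext fun i j => eq_of_heq
      ((Mor2.hcomp_assoc (𝟙 H) T (𝟙 F) i j).symm.trans (Mor2.eqToHom_conj_heq _ _ _ i j).symm)
  pentagon F G H K := by
    simp only [eqToIso.hom, ← eqToHom_refl, Mor2.hcomp_eqToHom, eqToHom_trans]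
  triangle F G := by
    simp only [eqToIso.hom, ← eqToHom_refl, Mor2.hcomp_eqToHom, eqToHom_trans]

instance : Bicategory.Strict TwoMat where
  id_comp {X Y} F := Mor.comp_one (n := X.dim) (m := Y.dim) F
  comp_id {X Y} F := Mor.one_comp (n := X.dim) (m := Y.dim) F
  assoc {X Y Z W} F G H :=
    Mor.comp_assoc (n := X.dim) (m := Y.dim) (l := Z.dim) (k := W.dim) H G F
  leftUnitor_eqToIso _ := rfl
  rightUnitor_eqToIso _ := rfl
  associator_eqToIso _ _ _ := rfl

end TwoMat

/-- A (weak) 2-group: a monoidal category in which every morphism is invertible and every object is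
invertible, in the sense that both translations by it are equivalences. -/
class TwoGroup (G : Type*) [Category G] [MonoidalCategory G] : Prop where
  isGroupoid : IsGroupoid G
  tensorLeft_isEquivalence (A : G) : (tensorLeft A).IsEquivalence
  tensorRight_isEquivalence (A : G) : (tensorRight A).IsEquivalence

namespace TwoGroup

attribute [instance] isGroupoid tensorLeft_isEquivalence tensorRight_isEquivalence

universe v u

/-- The set of isomorphism classes of objects. -/
def Pi0 (G : Type u) [Category.{v} G] : Type u := Quotient (isIsomorphicSetoid G)

/-- The automorphisms of the unit object. -/
abbrev Pi1 (G : Type u) [Category.{v} G] [MonoidalCategory G] : Type v := Aut (𝟙_ G)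

section

variable {G : Type u} [Category.{v} G]

/-- The isomorphism class of an object. -/
def cls (A : G) : Pi0 G := Quotient.mk _ A

theorem cls_eq_iff {A B : G} : cls A = cls B ↔ Nonempty (A ≅ B) := Quotient.eq

theorem mul_hom {A : G} (f g : Aut A) : (f * g).hom = g.hom ≫ f.hom := rfl

variable [MonoidalCategory G]

instance : Mul (Pi0 G) where
  mul := Quotient.map₂ (· ⊗ ·) fun _ _ ⟨f⟩ _ _ ⟨g⟩ => ⟨f ⊗ᵢ g⟩

instance : One (Pi0 G) := ⟨cls (𝟙_ G)⟩

variable [TwoGroup G]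

theorem exists_left_inverse (g : Pi0 G) : ∃ h : Pi0 G, h * g = 1 := by
  obtain ⟨A, rfl⟩ := Quotient.exists_rep g
  exact ⟨cls ((tensorRight A).objPreimage (𝟙_ G)),
    cls_eq_iff.2 ⟨(tensorRight A).objObjPreimageIso (𝟙_ G)⟩⟩

/-- Isomorphism classes of objects form a group under the tensor product. -/
noncomputable instance : Group (Pi0 G) :=
  { mul := (· * ·)
    one := 1
    inv := fun g => (exists_left_inverse g).choose
    mul_assoc := by
      rintro ⟨A⟩ ⟨B⟩ ⟨C⟩
      exact cls_eq_iff.2 ⟨α_ A B C⟩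
    one_mul := by
      rintro ⟨A⟩
      exact cls_eq_iff.2 ⟨λ_ A⟩
    mul_one := by
      rintro ⟨A⟩
      exact cls_eq_iff.2 ⟨ρ_ A⟩
    inv_mul_cancel := fun g => (exists_left_inverse g).choose_spec }

end

section

variable {G : Type u} [Category.{v} G] [MonoidalCategory G]

theorem unit_whisker (u : Pi1 G) : u.hom ▷ 𝟙_ G = (λ_ (𝟙_ G)).hom ≫ u.hom ≫ (λ_ (𝟙_ G)).inv := by
  rw [unitors_equal, unitors_inv_equal, ← rightUnitor_naturality_assoc, Iso.hom_inv_id,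
    Category.comp_id]

theorem whisker_unit (u : Pi1 G) : 𝟙_ G ◁ u.hom = (λ_ (𝟙_ G)).hom ≫ u.hom ≫ (λ_ (𝟙_ G)).inv := by
  rw [← leftUnitor_naturality_assoc, Iso.hom_inv_id, Category.comp_id]

/-- Automorphisms of the unit object form an abelian group under composition. -/
instance : CommGroup (Pi1 G) where
  mul_comm u v := by
    have h := whisker_exchange u.hom v.hom
    rw [unit_whisker, whisker_unit] at h
    simp only [Category.assoc, Iso.inv_hom_id_assoc, cancel_epi] at h
    simp only [← Category.assoc, cancel_mono] at h
    apply Aut.ext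
    rw [mul_hom, mul_hom]
    exact h

/-- `γ_A(u) = l_A ∘ (u ⊗ id) ∘ l_A⁻¹`. -/
def gamma (A : G) : Pi1 G →* Aut A where
  toFun u := (show A ≅ A from (λ_ A).symm ≪≫ whiskerRightIso (show 𝟙_ G ≅ 𝟙_ G from u) A ≪≫ λ_ A)
  map_one' := by
    apply Aut.ext
    change (λ_ A).inv ≫ 𝟙 (𝟙_ G) ▷ A ≫ (λ_ A).hom = 𝟙 A
    simp
  map_mul' u v := by
    apply Aut.ext
    change (λ_ A).inv ≫ (v.hom ≫ u.hom) ▷ A ≫ (λ_ A).hom =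
      ((λ_ A).inv ≫ v.hom ▷ A ≫ (λ_ A).hom) ≫ ((λ_ A).inv ≫ u.hom ▷ A ≫ (λ_ A).hom)
    simp

/-- `δ_A(u) = r_A ∘ (id ⊗ u) ∘ r_A⁻¹`. -/
def delta (A : G) : Pi1 G →* Aut A where
  toFun u := (show A ≅ A from (ρ_ A).symm ≪≫ whiskerLeftIso A (show 𝟙_ G ≅ 𝟙_ G from u) ≪≫ ρ_ A)
  map_one' := by
    apply Aut.ext
    change (ρ_ A).inv ≫ A ◁ 𝟙 (𝟙_ G) ≫ (ρ_ A).hom = 𝟙 A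
    simp
  map_mul' u v := by
    apply Aut.ext
    change (ρ_ A).inv ≫ A ◁ (v.hom ≫ u.hom) ≫ (ρ_ A).hom =
      ((ρ_ A).inv ≫ A ◁ v.hom ≫ (ρ_ A).hom) ≫ ((ρ_ A).inv ≫ A ◁ u.hom ≫ (ρ_ A).hom)
    simp

theorem gamma_hom (A : G) (u : Pi1 G) :
    (gamma A u).hom = (λ_ A).inv ≫ u.hom ▷ A ≫ (λ_ A).hom := rfl

theorem delta_hom (A : G) (u : Pi1 G) :
    (delta A u).hom = (ρ_ A).inv ≫ A ◁ u.hom ≫ (ρ_ A).hom := rfl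

theorem gamma_naturality {A B : G} (f : A ⟶ B) (u : Pi1 G) :
    f ≫ (gamma B u).hom = (gamma A u).hom ≫ f := by
  simp only [gamma_hom, Category.assoc, ← leftUnitor_naturality, whisker_exchange_assoc,
    leftUnitor_inv_naturality_assoc]

theorem delta_naturality {A B : G} (f : A ⟶ B) (u : Pi1 G) :
    f ≫ (delta B u).hom = (delta A u).hom ≫ f := by
  simp only [delta_hom, Category.assoc, ← rightUnitor_naturality, ← whisker_exchange_assoc,
    rightUnitor_inv_naturality_assoc]

theorem gamma_unit (u : Pi1 G) : gamma (𝟙_ G) u = u := by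
  apply Aut.ext
  rw [gamma_hom, unit_whisker]; simp

theorem delta_unit (u : Pi1 G) : delta (𝟙_ G) u = u := by
  apply Aut.ext
  rw [delta_hom, whisker_unit, unitors_equal, unitors_inv_equal]; simp

theorem gamma_tensor (A B : G) (u : Pi1 G) :
    (gamma (A ⊗ B) u).hom = (gamma A u).hom ▷ B := by
  simp [gamma_hom]

theorem delta_tensor (A B : G) (u : Pi1 G) :
    (delta (A ⊗ B) u).hom = A ◁ (delta B u).hom := by
  simp [delta_hom]

theorem whisker_gamma (A B : G) (u : Pi1 G) :
    A ◁ (gamma B u).hom = (delta A u).hom ▷ B := by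
  rw [gamma_hom, delta_hom, ← cancel_mono (A ◁ (λ_ B).inv), ← cancel_mono (α_ A (𝟙_ G) B).inv]
  simp

variable [TwoGroup G]

theorem gamma_bijective (A : G) : Function.Bijective (gamma A) := by
  constructor
  · intro u v h
    have h : (gamma A u).hom = (gamma A v).hom := congrArg _ h
    rw [gamma_hom, gamma_hom, cancel_epi, cancel_mono] at h
    apply Aut.ext
    exact (tensorRight A).map_injective h
  · intro f
    let e : (tensorRight A).obj (𝟙_ G) ≅ (tensorRight A).obj (𝟙_ G) :=
      λ_ A ≪≫ (show A ≅ A from f) ≪≫ (λ_ A).symm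
    let u : Pi1 G := (tensorRight A).preimageIso e
    have h : u.hom ▷ A = (λ_ A).hom ≫ f.hom ≫ (λ_ A).inv := (tensorRight A).map_preimage e.hom
    refine ⟨u, ?_⟩
    apply Aut.ext
    rw [gamma_hom, h]
    simp

/-- `γ_A` as an isomorphism of groups. -/
noncomputable def gammaEquiv (A : G) : Pi1 G ≃* Aut A :=
  MulEquiv.ofBijective (gamma A) (gamma_bijective A)

theorem gamma_symm (A : G) (f : Aut A) : gamma A ((gammaEquiv A).symm f) = f :=
  (gammaEquiv A).apply_symm_apply f

/-- `γ_A⁻¹ ∘ δ_A`. -/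
noncomputable def act (A : G) : Pi1 G →* Pi1 G :=
  (gammaEquiv A).symm.toMonoidHom.comp (delta A)

theorem gamma_act (A : G) (u : Pi1 G) : gamma A (act A u) = delta A u :=
  gamma_symm A _

theorem act_congr {A B : G} (f : A ≅ B) : act A = act B := by
  ext1 u
  apply (gamma_bijective B).1
  rw [gamma_act]
  apply Aut.ext
  rw [← cancel_epi f.hom, gamma_naturality, gamma_act, delta_naturality]

theorem act_unit (u : Pi1 G) : act (𝟙_ G) u = u := by
  apply (gamma_bijective (𝟙_ G)).1
  rw [gamma_act, delta_unit, gamma_unit]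

theorem act_tensor (A B : G) (u : Pi1 G) : act (A ⊗ B) u = act A (act B u) := by
  apply (gamma_bijective (A ⊗ B)).1
  rw [gamma_act]
  apply Aut.ext
  rw [delta_tensor, gamma_tensor, gamma_act, ← whisker_gamma, gamma_act]

/-- The action of the group of isomorphism classes of objects on the group of automorphisms of the
unit object: the class of `A` acts by `γ_A⁻¹ ∘ δ_A`. -/
noncomputable instance : MulDistribMulAction (Pi0 G) (Pi1 G) where
  smul g u := Quotient.lift (s := isIsomorphicSetoid G) (fun A : G => act A) (fun _ _ h => h.elim fun f => act_congr f) g u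
  one_smul := act_unit
  mul_smul := by
    rintro ⟨A⟩ ⟨B⟩ u
    exact act_tensor A B u
  smul_mul := by
    rintro ⟨A⟩ u v
    exact map_mul (act A) u v
  smul_one := by
    rintro ⟨A⟩
    exact map_one (act A)

end

end TwoGroup

/-! Normalized cochains of a group `Γ` with values in an abelian group `M` on which `Γ` acts. -/

namespace Cochain

variable {Γ M : Type*} [Group Γ] [CommGroup M]

/-- The coboundary of a 2-cochain. -/
def d2 (φ : Γ →* MulAut M) (c : Γ → Γ → M) (g h k : Γ) : M :=
  φ g (c h k) * (c (g * h) k)⁻¹ * c g (h * k) * (c g h)⁻¹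

/-- The coboundary of a 3-cochain. -/
def d3 (φ : Γ →* MulAut M) (a : Γ → Γ → Γ → M) (g h k l : Γ) : M :=
  φ g (a h k l) * (a (g * h) k l)⁻¹ * a g (h * k) l * (a g h (k * l))⁻¹ * a g h k

/-- A 2-cochain is normalized if it vanishes when one of its arguments is the unit. -/
def IsNormalized (c : Γ → Γ → M) : Prop := ∀ g, c 1 g = 1 ∧ c g 1 = 1

/-- The class of a 3-cocycle `a` in the third cohomology group is trivial, that is, `a` is a
coboundary. -/
def IsTrivialClass (φ : Γ →* MulAut M) (a : Γ → Γ → Γ → M) : Prop :=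
  ∃ b : Γ → Γ → M, d2 φ b = a

/-- A normalized 3-cocycle. -/
structure Cocycle3 (φ : Γ →* MulAut M) where
  val : Γ → Γ → Γ → M
  normalized : ∀ g h, val 1 g h = 1 ∧ val g 1 h = 1 ∧ val g h 1 = 1
  cocycle : d3 φ val = 1

end Cochain

/-- The symmetric group acts on `(ℂˣ)ⁿ` by `(σ · x)_i = x_{σ⁻¹(i)}`. -/
def permAction (n : ℕ) : Equiv.Perm (Fin n) →* MulAut (Fin n → ℂˣ) where
  toFun σ :=
    { toFun := fun x i => x (σ⁻¹ i)
      invFun := fun x i => x (σ i)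
      left_inv := fun x => by funext i; simp
      right_inv := fun x => by funext i; simp
      map_mul' := fun _ _ => rfl }
  map_one' := rfl
  map_mul' _ _ := rfl

namespace TwoGroup

universe v u

variable (G : Type u) [Category.{v} G] [MonoidalCategory G] [TwoGroup G]

/-- The action of `π₀` on `π₁`. -/
noncomputable abbrev piAction : Pi0 G →* MulAut (Pi1 G) :=
  MulDistribMulAction.toMulAut (Pi0 G) (Pi1 G)

/-- A choice of representatives of the isomorphism classes of objects, the unit object being one of
them, and of isomorphisms from their tensor products to representatives, which are the unit
isomorphisms when one of the factors is the unit object. -/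
structure Transversal where
  obj : Pi0 G → G
  cls_obj (g : Pi0 G) : cls (obj g) = g
  obj_one : obj 1 = 𝟙_ G
  mu (g h : Pi0 G) : obj g ⊗ obj h ≅ obj (g * h)
  mu_one_left (g : Pi0 G) : (mu 1 g).hom =
    eqToHom (by rw [obj_one]) ≫ (λ_ (obj g)).hom ≫ eqToHom (by rw [one_mul])
  mu_one_right (g : Pi0 G) : (mu g 1).hom =
    eqToHom (by rw [obj_one]) ≫ (ρ_ (obj g)).hom ≫ eqToHom (by rw [mul_one])

variable {G}

namespace Transversal

/-- The associator transported to the representatives, an automorphism of the representative of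
`g * h * k`. -/
def assoc (S : Transversal G) (g h k : Pi0 G) : S.obj (g * h * k) ⟶ S.obj (g * h * k) :=
  (S.mu (g * h) k).inv ≫ (S.mu g h).inv ▷ S.obj k ≫ (α_ _ _ _).hom ≫
    S.obj g ◁ (S.mu h k).hom ≫ (S.mu g (h * k)).hom ≫ eqToHom (by rw [mul_assoc])

end Transversal

/-- `α` is the classifying 3-cocycle computed from the choices `S`:
`α(g, h, k) = γ⁻¹ (assoc g h k)`. -/
def IsClassifying (S : Transversal G) (α : Cochain.Cocycle3 (piAction G)) : Prop :=
  ∀ g h k, (gamma (S.obj (g * h * k)) (α.val g h k)).hom = S.assoc g h k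

/-- For a given `n`, a homomorphism `ρ : π₀ → S_n`, a homomorphism of `π₀`-modules
`β : π₁ → (ℂˣ)ⁿ_ρ` with `[β ∘ α] = 0`, and a normalized 2-cochain `c` with `∂c = β ∘ α`. -/
structure QuadrupleOfDim (α : Cochain.Cocycle3 (piAction G)) (n : ℕ) where
  ρ : Pi0 G →* Equiv.Perm (Fin n)
  β : Pi1 G →* (Fin n → ℂˣ)
  map_smul (g : Pi0 G) (u : Pi1 G) : β (g • u) = permAction n (ρ g) (β u)
  isTrivialClass : Cochain.IsTrivialClass ((permAction n).comp ρ) (fun g h k => β (α.val g h k))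
  c : Pi0 G → Pi0 G → Fin n → ℂˣ
  isNormalized : Cochain.IsNormalized c
  coboundary : Cochain.d2 ((permAction n).comp ρ) c = fun g h k => β (α.val g h k)

/-- A quadruple `(n, ρ, β, c)` with `n ≥ 1`. -/
structure Quadruple (α : Cochain.Cocycle3 (piAction G)) where
  n : ℕ
  one_le : 1 ≤ n
  data : QuadrupleOfDim α n

end TwoGroup

/-- The 1-morphism of a permutation: the permutation matrix `P(σ)_{ij} = δ_{i, σ(j)}`, with the
trivial gauge. -/
def TwoMatrix.Mor.perm {n : ℕ} (σ : Equiv.Perm (Fin n)) : TwoMatrix.Mor n n where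
  rank i j := if i = σ j then 1 else 0
  gauge _ _ := 1
  gauge_single _ _ := rfl

namespace TwoGroup

open TwoMatrix Bicategory
open scoped CategoryTheory.Pseudofunctor.StrongTrans

universe v u

/-- The 2-matrix representations of a 2-group: pseudofunctors to the 2-category of 2-matrices from
the one-object bicategory of the 2-group. The tensor product is reversed because in the latter the
composite of maps `A ∘ B` is `A ⊗ B`, whereas the bicategory of a monoidal category has
`A ≫ B = A ⊗ B`. -/
abbrev Representation (G : Type u) [Category.{v} G] [MonoidalCategory G] :=
  Pseudofunctor (MonoidalSingleObj Gᴹᵒᵖ) TwoMat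

namespace Representation

variable {G : Type u} [Category.{v} G] [MonoidalCategory G]

/-- The dimension of a representation. -/
def dim (F : Representation G) : ℕ := (F.obj (MonoidalSingleObj.star Gᴹᵒᵖ)).dim

/-- The 1-morphism representing an object. -/
def onObj (F : Representation G) (A : G) : Mor F.dim F.dim :=
  F.map (X := MonoidalSingleObj.star Gᴹᵒᵖ) (Y := MonoidalSingleObj.star Gᴹᵒᵖ)
    (MonoidalOpposite.mop A)

/-- The 2-morphism representing a morphism. -/
def onHom (F : Representation G) {A B : G} (f : A ⟶ B) : F.onObj A ⟶ F.onObj B :=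
  F.map₂ (a := MonoidalSingleObj.star Gᴹᵒᵖ) (b := MonoidalSingleObj.star Gᴹᵒᵖ) f.mop

/-- The structural 2-isomorphism `F(A) ∘ F(B) ⟶ F(A ⊗ B)`. -/
def tensor (F : Representation G) (A B : G) :
    Mor.comp (F.onObj A) (F.onObj B) ⟶ F.onObj (A ⊗ B) :=
  (F.mapComp (a := MonoidalSingleObj.star Gᴹᵒᵖ) (b := MonoidalSingleObj.star Gᴹᵒᵖ)
    (c := MonoidalSingleObj.star Gᴹᵒᵖ) (MonoidalOpposite.mop B) (MonoidalOpposite.mop A)).inv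

/-- The structural 2-isomorphism `id ⟶ F(I)`. -/
def unit (F : Representation G) : Mor.one F.dim ⟶ F.onObj (𝟙_ G) :=
  (F.mapId (MonoidalSingleObj.star Gᴹᵒᵖ)).inv

/-- Two representations are isomorphic if there is a strictly invertible 1-intertwiner, that is, a
strictly invertible pseudonatural transformation, between them. -/
def Isomorphic (F F' : Representation G) : Prop :=
  ∃ (ξ : F ⟶ F') (η : F' ⟶ F), ξ ≫ η = 𝟙 F ∧ η ≫ ξ = 𝟙 F'

variable [TwoGroup G] (S : Transversal G) {α : Cochain.Cocycle3 (piAction G)}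

/-- On the chosen representatives, `F` is the gauge trivial representation of the quadruple
`(n, ρ, β, c)`, with `n` the dimension of `F`:
* `F(A_g) = (P(ρ(g)), I)`;
* `F(γ(u))_{ρ(g)(j), j} = β(u)_{ρ(g)(j)}` for `u` in `π₁`;
* `F(μ_{g, h}) ∘ F₂(A_g, A_h) : F(A_g) ∘ F(A_h) ⟶ F(A_{gh})` has the entries `c(g, h)_{ρ(gh)(j)}`
  in the positions `(ρ(gh)(j), j)`;
* the 2-isomorphism `id ⟶ F(I)` is the identity.
All these entries are matrices with one row and one column. -/
structure IsGaugeTrivial (F : Representation G) (q : QuadrupleOfDim α F.dim) : Prop where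
  obj (g : Pi0 G) : F.onObj (S.obj g) = Mor.perm (q.ρ g)
  hom (g : Pi0 G) (u : Pi1 G) (j : Fin F.dim) (x y) :
    (F.onHom (gamma (S.obj g) u).hom).entry (q.ρ g j) j x y = q.β u (q.ρ g j)
  tensor (g h : Pi0 G) (j : Fin F.dim) (x y) :
    (F.tensor (S.obj g) (S.obj h) ≫ F.onHom (S.mu g h).hom).entry (q.ρ (g * h) j) j x y =
      q.c g h (q.ρ (g * h) j)
  unit (j : Fin F.dim) (x y) : F.unit.entry j j x y = 1

/-- `F` is an explicit representation of the quadruple `q`. -/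
def Realizes (F : Representation G) (q : Quadruple α) : Prop :=
  ∃ h : q.n = F.dim, IsGaugeTrivial S F (h ▸ q.data)

end Representation

end TwoGroup

/-!
A 2-isomorphism of 2-matrices forces the rank matrices to be equal, so the rank matrices of a
representation form a homomorphism from `π₀` to the invertible matrices over `ℕ`, which are the
permutation matrices (`RepData.exists_permHom`). Between permutation matrices, a 2-morphism has
entries of size at most one, so it is given by a single complex matrix `scal`, a monomial matrix if
the 2-morphism is invertible. Vertical composition multiplies these matrices entrywise, and
horizontal composition is the matrix product (`scal_comp`, `scal_hcomp`): the gauges that occur in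
horizontal composition are evaluated at columns of permutation matrices, that is, at basis vectors,
where they are trivial. Hence nothing depends on the gauges, and a representation is described by
families of `n`-tuples of nonzero scalars subject to multiplicative equations (`ScalarRep`,
`RepData.exists_models`). Conversely, every such family comes from a representation by permutation
matrices with trivial gauges (`ScalarRep.toRepData`).

If the scalars of two representations differ by a change of bases (`ScalarRep.IsGauge`), the factors
of this change are the entries of a pseudonatural transformation whose 1-morphism is the identity.
Since the identity composes strictly, the transformation is strictly invertible
(`RepData.Models.isomorphic`).

It remains to compare families of scalars with quadruples. An isomorphism is chosen from each object
to the representative of its class, the identity if the object is a representative. Parallel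
morphisms of a 2-group differ by an element of `π₁` (`diff`), so each morphism has a deviation in
`π₁` from the chosen identifications (`Transversal.dev`), and each tensor product has a deviation
from the isomorphisms `μ` (`Transversal.tensorDev`). The deviation of the associator is the
classifying cocycle up to the coboundary of the latter (`Transversal.dev_associator_inv`). A
quadruple therefore defines scalars, by letting morphisms act through `β` and their deviations, and
tensor products through `c` corrected by `β` of their deviations (`QuadrupleOfDim.toScalarRep`); the
equation `∂c = β ∘ α` is exactly the compatibility with the associator. Conversely, scalars restrict
to a quadruple on the representatives (`ScalarRep.exists_matches`), and they are recovered from it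
up to the change of bases given by the scalars of the chosen isomorphisms
(`ScalarRep.Matches.isGauge`). This proves existence, and it proves uniqueness up to isomorphism
because the scalars of a gauge trivial representation restrict to its quadruple
(`RepData.Models.matches_of_isGaugeTrivial`).
-/

/-! ### Monomial matrices and the scalars of a 2-morphism -/

namespace TwoMatrix

/-- The monomial matrix with the entry `x (σ j)` in each position `(σ j, j)` and zeros
elsewhere. -/
def monomial {n : ℕ} (x : Fin n → ℂˣ) (σ : Equiv.Perm (Fin n)) : Matrix (Fin n) (Fin n) ℂ :=
  fun i j => if i = σ j then (x i : ℂ) else 0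

theorem monomial_apply {n : ℕ} (x : Fin n → ℂˣ) {σ : Equiv.Perm (Fin n)} {i j : Fin n}
    (h : i = σ j) : monomial x σ i j = x i := if_pos h

theorem monomial_apply_ne {n : ℕ} (x : Fin n → ℂˣ) {σ : Equiv.Perm (Fin n)} {i j : Fin n}
    (h : i ≠ σ j) : monomial x σ i j = 0 := if_neg h

theorem monomial_one (n : ℕ) : monomial (1 : Fin n → ℂˣ) 1 = 1 := by
  ext i j
  by_cases h : i = j <;> simp [monomial, Matrix.one_apply, h]

/-- The multiplication of monomial matrices is that of the semidirect product `(ℂˣ)ⁿ ⋊ S_n`. -/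
theorem monomial_mul {n : ℕ} (x y : Fin n → ℂˣ) (σ τ : Equiv.Perm (Fin n)) :
    monomial x σ * monomial y τ = monomial (x * permAction n σ y) (σ * τ) := by
  ext i j
  rw [Matrix.mul_apply, Finset.sum_eq_single (σ⁻¹ i), monomial_apply x (by simp)]
  · by_cases h : i = σ (τ j)
    · rw [monomial_apply _ (show i = (σ * τ) j from h), monomial_apply _ (by simp [h])]
      rfl
    · rw [monomial_apply_ne _ (show i ≠ (σ * τ) j from h), monomial_apply_ne, mul_zero]
      exact fun h' => h (by rw [← h']; simp)
  · intro k _ hk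
    rw [monomial_apply_ne _ fun h => hk (by rw [h]; simp), zero_mul]
  · simp

theorem monomial_hadamard {n : ℕ} (x y : Fin n → ℂˣ) (σ : Equiv.Perm (Fin n)) :
    Matrix.hadamard (monomial x σ) (monomial y σ) = monomial (x * y) σ := by
  ext i j
  by_cases h : i = σ j <;> simp [monomial, Matrix.hadamard, h]

theorem monomial_injective {n : ℕ} {x y : Fin n → ℂˣ} {σ τ : Equiv.Perm (Fin n)}
    (h : monomial x σ = monomial y τ) : x = y ∧ σ = τ := by
  have hσ : σ = τ := by
    ext j
    have := congrFun (congrFun h (σ j)) j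
    by_contra hne
    simp [monomial, Fin.ext_iff, hne] at this
  refine ⟨?_, hσ⟩
  subst hσ
  funext i
  have := congrFun (congrFun h i) (σ⁻¹ i)
  simpa [monomial, Units.ext_iff] using this

theorem sum_sumKron {m : ℕ} {r r' t t' : Fin m → ℕ}
    (T : ∀ j, Matrix (Fin (r' j)) (Fin (r j)) ℂ) (U : ∀ j, Matrix (Fin (t' j)) (Fin (t j)) ℂ) :
    ∑ u, ∑ v, sumKron T U u v = ∑ j, (∑ p, ∑ q, T j p q) * ∑ p, ∑ q, U j p q := by
  rw [← Equiv.sum_comp (flat r' t'), Fintype.sum_sigma]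
  refine Finset.sum_congr rfl fun j _ => ?_
  rw [Fintype.sum_mul_sum, Fintype.sum_prod_type]
  refine Finset.sum_congr rfl fun p _ => Finset.sum_congr rfl fun q _ => ?_
  rw [← Equiv.sum_comp (flat r t), Fintype.sum_sigma, Finset.sum_eq_single j]
  · simp only [sumKron_apply_eq, Fintype.sum_prod_type, Fintype.sum_mul_sum]
  · intro j' _ hj
    exact Finset.sum_eq_zero fun x _ => sumKron_apply_ne T U hj.symm (p, q) x
  · simp

namespace Mor

/-- The rank matrix of `F` is the permutation matrix of `σ`; the gauge is arbitrary. -/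
def IsPerm {n : ℕ} (F : Mor n n) (σ : Equiv.Perm (Fin n)) : Prop :=
  ∀ i j, F.rank i j = if i = σ j then 1 else 0

/-- The rank matrix of `F` is a permutation matrix. -/
class HasPermRank {n : ℕ} (F : Mor n n) : Prop where
  exists_perm : ∃ σ : Equiv.Perm (Fin n), F.IsPerm σ

/-- The rank matrix with complex entries. -/
def rankC {n : ℕ} (F : Mor n n) : Matrix (Fin n) (Fin n) ℂ := fun i j => (F.rank i j : ℂ)

variable {n : ℕ}

theorem IsPerm.hasPermRank {F : Mor n n} {σ : Equiv.Perm (Fin n)} (h : F.IsPerm σ) :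
    F.HasPermRank := ⟨σ, h⟩

theorem isPerm_perm (σ : Equiv.Perm (Fin n)) : (perm σ).IsPerm σ := fun _ _ => rfl

theorem isPerm_one : (one n).IsPerm 1 := fun i j => by
  by_cases h : i = j <;> simp [one, h]

theorem IsPerm.comp {F H : Mor n n} {σ τ : Equiv.Perm (Fin n)} (hF : F.IsPerm σ)
    (hH : H.IsPerm τ) : (Mor.comp F H).IsPerm (σ * τ) := fun i j => by
  change ∑ k, F.rank i k * H.rank k j = _
  rw [Finset.sum_eq_single (τ j), hF, hH, if_pos rfl, mul_one]
  · rfl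
  · intro k _ hk
    rw [hH, if_neg hk, mul_zero]
  · simp

instance (σ : Equiv.Perm (Fin n)) : (perm σ).HasPermRank := (isPerm_perm σ).hasPermRank

instance : (one n).HasPermRank := isPerm_one.hasPermRank

instance (F H : Mor n n) [hF : F.HasPermRank] [hH : H.HasPermRank] :
    (Mor.comp F H).HasPermRank := by
  obtain ⟨σ, hσ⟩ := hF
  obtain ⟨τ, hτ⟩ := hH
  exact (IsPerm.comp hσ hτ).hasPermRank

theorem IsPerm.rankC {F : Mor n n} {σ : Equiv.Perm (Fin n)} (hF : F.IsPerm σ) :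
    F.rankC = monomial 1 σ := by
  ext i j
  simp [Mor.rankC, hF i j, monomial]

theorem rankC_perm (σ : Equiv.Perm (Fin n)) : (perm σ).rankC = monomial 1 σ :=
  (isPerm_perm σ).rankC

theorem rankC_one : (one n).rankC = monomial 1 1 := isPerm_one.rankC

theorem rankC_one_eq : (one n).rankC = 1 := rankC_one.trans (monomial_one n)

theorem rankC_comp (F H : Mor n n) : (Mor.comp F H).rankC = F.rankC * H.rankC := by
  ext i j
  simp [Mor.rankC, Mor.comp, Matrix.mul_apply]

theorem rank_le_one (F : Mor n n) [hF : F.HasPermRank] (i j : Fin n) : F.rank i j ≤ 1 := by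
  obtain ⟨σ, hσ⟩ := hF
  rw [hσ]; split_ifs <;> simp

theorem exists_rank_eq_single (F : Mor n n) [hF : F.HasPermRank] (j : Fin n) :
    ∃ k, (fun i => F.rank i j) = Pi.single k 1 := by
  obtain ⟨σ, hσ⟩ := hF
  exact ⟨σ j, by funext i; simp [hσ i j, Pi.single_apply]⟩

/-- A gauge is trivial on the columns of a permutation matrix, as these are basis vectors. -/
theorem gauge_eq_one (H F : Mor n n) [F.HasPermRank] (k j : Fin n) :
    H.gauge k (fun i => F.rank i j) = 1 := by
  have key : ∀ (a : Fin n → ℕ) (l : Fin n), a = Pi.single l 1 → H.gauge k a = 1 := by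
    rintro a l rfl
    exact H.gauge_single k l
  obtain ⟨l, hl⟩ := F.exists_rank_eq_single j
  exact key _ l hl

end Mor

namespace Mor2

variable {n : ℕ}

/-- The matrix of the sums of the entries of the blocks of a 2-morphism. If the rank matrices are
permutation matrices, the blocks have at most one entry, and this matrix has the same information
as the 2-morphism. -/
def scal {F H : Mor n n} (T : F ⟶ H) : Matrix (Fin n) (Fin n) ℂ :=
  fun i j => ∑ p, ∑ q, T.entry i j p q

theorem scal_id (F : Mor n n) : scal (𝟙 F) = F.rankC := by
  ext i j
  change ∑ p, ∑ q, (1 : Matrix _ _ ℂ) p q = _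
  simp [Matrix.one_apply, Mor.rankC]

theorem scal_eqToHom {F H : Mor n n} (h : F = H) : scal (eqToHom h) = F.rankC := by
  subst h; exact scal_id F

/-- Vertical composition is entrywise multiplication. -/
theorem scal_comp {F H K : Mor n n} [H.HasPermRank] (S : F ⟶ H) (T : H ⟶ K) :
    scal (S ≫ T) = Matrix.hadamard (scal S) (scal T) := by
  ext i j
  change ∑ p, ∑ q, (T.entry i j * S.entry i j) p q =
    (∑ p, ∑ q, S.entry i j p q) * ∑ p, ∑ q, T.entry i j p q
  have key : ∀ (a b c : ℕ) (hb : b ≤ 1) (M : Matrix (Fin a) (Fin b) ℂ)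
      (N : Matrix (Fin b) (Fin c) ℂ),
      ∑ p, ∑ q, (M * N) p q = (∑ p, ∑ q, N p q) * ∑ p, ∑ q, M p q := by
    intro a b c hb M N
    interval_cases b
    · simp [Matrix.mul_apply]
    · simp only [Matrix.mul_apply, Finset.univ_unique, Finset.sum_singleton,
        ← Finset.mul_sum, ← Finset.sum_mul]
      ring
  exact key _ _ _ (H.rank_le_one i j) _ _

/-- Horizontal composition is matrix multiplication: the gauges in its definition are trivial. -/
theorem scal_hcomp {K K' F F' : Mor n n} [F.HasPermRank] [F'.HasPermRank] (S : K ⟶ K')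
    (T : F ⟶ F') : scal (hcomp S T) = scal S * scal T := by
  ext k j
  have h : (hcomp S T).entry k j = sumKron (fun i => S.entry k i) (fun i => T.entry i j) := by
    have : (K'.gauge k (fun i => F'.rank i j)).val *
        sumKron (fun i => S.entry k i) (fun i => T.entry i j) *
        (K.gauge k (fun i => F.rank i j))⁻¹.val =
        sumKron (fun i => S.entry k i) (fun i => T.entry i j) := by
      rw [Mor.gauge_eq_one, Mor.gauge_eq_one, inv_one, Units.val_one, Units.val_one,
        Matrix.one_mul, Matrix.mul_one]
    exact this
  rw [Matrix.mul_apply]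
  unfold scal
  rw [h]
  exact sum_sumKron _ _

/-- A 2-morphism between permutation matrices is determined by its scalars. -/
theorem ext_scal {F H : Mor n n} [F.HasPermRank] [H.HasPermRank] {S T : F ⟶ H}
    (h : scal S = scal T) : S = T := by
  refine hom_ext fun i j => ?_
  have h' := congrFun (congrFun h i) j
  change ∑ p, ∑ q, S.entry i j p q = ∑ p, ∑ q, T.entry i j p q at h'
  have key : ∀ (a b : ℕ) (ha : a ≤ 1) (hb : b ≤ 1) (M N : Matrix (Fin a) (Fin b) ℂ),
      ∑ p, ∑ q, M p q = ∑ p, ∑ q, N p q → M = N := by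
    intro a b ha hb M N hMN
    interval_cases a <;> interval_cases b <;> ext p q
    · exact p.elim0
    · exact p.elim0
    · exact q.elim0
    · simpa [Subsingleton.elim p 0, Subsingleton.elim q 0] using hMN
  exact key _ _ (H.rank_le_one i j) (F.rank_le_one i j) _ _ h'

/-- A form of `ext_scal` for 2-isomorphisms whose sources and targets are equal, but not by
definition. -/
theorem heq_of_scal {F F' H H' : Mor n n} [F.HasPermRank] [H.HasPermRank] (hF : F = F')
    (hH : H = H') {S : F ≅ H} {T : F' ≅ H'} (h : scal S.hom = scal T.hom) : HEq S T := by
  subst hF hH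
  exact heq_of_eq (Iso.ext (ext_scal h))

/-- The entries of a 2-morphism between permutation matrices are the nonzero entries of the monomial
matrix that it defines. -/
theorem entry_of_scal {F H : Mor n n} {σ : Equiv.Perm (Fin n)} (hF : F.IsPerm σ)
    (hH : H.IsPerm σ) {T : F ⟶ H} {x : Fin n → ℂˣ} (h : scal T = monomial x σ) (j : Fin n)
    (p q) : T.entry (σ j) j p q = x (σ j) := by
  have h' := congrFun (congrFun h (σ j)) j
  change ∑ p, ∑ q, T.entry (σ j) j p q = _ at h'
  have key : ∀ (a b : ℕ) (ha : a = 1) (hb : b = 1) (M : Matrix (Fin a) (Fin b) ℂ) (p q),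
      ∑ p, ∑ q, M p q = M p q := by
    intro a b ha hb M p q
    subst ha hb
    simp [Subsingleton.elim p 0, Subsingleton.elim q 0]
  rw [key _ _ (by simp [hH (σ j) j]) (by simp [hF (σ j) j]) _ p q] at h'
  simpa [monomial] using h'

theorem scal_of_entry {F H : Mor n n} {σ : Equiv.Perm (Fin n)} (hF : F.IsPerm σ)
    (hH : H.IsPerm σ) {T : F ⟶ H} {x : Fin n → ℂˣ}
    (h : ∀ j p q, T.entry (σ j) j p q = x (σ j)) : scal T = monomial x σ := by
  ext i j
  by_cases hij : i = σ j
  · subst hij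
    change ∑ p, ∑ q, T.entry (σ j) j p q = _
    simp [h, monomial, hF (σ j) j, hH (σ j) j]
  · have : IsEmpty (Fin (H.rank i j)) := by rw [hH i j, if_neg hij]; infer_instance
    change ∑ p, ∑ q, T.entry i j p q = _
    simp [monomial, hij]

/-- The scalars of a 2-isomorphism are nonzero. -/
theorem exists_scal {F H : Mor n n} {σ : Equiv.Perm (Fin n)} (hF : F.IsPerm σ)
    (hH : H.IsPerm σ) (T : F ≅ H) : ∃ x, scal T.hom = monomial x σ := by
  have := hF.hasPermRank
  have := hH.hasPermRank
  have h1 : Matrix.hadamard (scal T.hom) (scal T.inv) = monomial 1 σ := by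
    rw [← scal_comp, T.hom_inv_id, scal_id, hF.rankC]
  have h2 : ∀ j, scal T.hom (σ j) j ≠ 0 := fun j h0 => by
    have := congrFun (congrFun h1 (σ j)) j
    simp [Matrix.hadamard, monomial, h0] at this
  refine ⟨fun i => Units.mk0 (scal T.hom i (σ⁻¹ i)) (by simpa using h2 (σ⁻¹ i)), ?_⟩
  ext i j
  by_cases hij : i = σ j
  · subst hij; simp [monomial]
  · have : IsEmpty (Fin (H.rank i j)) := by rw [hH i j, if_neg hij]; infer_instance
    change ∑ p, ∑ q, T.hom.entry i j p q = _
    simp [monomial, hij]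

/-- The 2-morphism between permutation matrices with given nonempty entries. -/
def ofScalHom (F H : Mor n n) (x : Fin n → ℂˣ) : F ⟶ H := ⟨fun i _ _ _ => x i⟩

theorem scal_ofScalHom {F H : Mor n n} {σ : Equiv.Perm (Fin n)} (hF : F.IsPerm σ)
    (hH : H.IsPerm σ) (x : Fin n → ℂˣ) : scal (ofScalHom F H x) = monomial x σ :=
  scal_of_entry hF hH fun _ _ _ => rfl

/-- The 2-isomorphism between permutation matrices with given nonempty entries. -/
def ofScal {F H : Mor n n} {σ : Equiv.Perm (Fin n)} (hF : F.IsPerm σ) (hH : H.IsPerm σ)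
    (x : Fin n → ℂˣ) : F ≅ H where
  hom := ofScalHom F H x
  inv := ofScalHom H F x⁻¹
  hom_inv_id := by
    have := hF.hasPermRank
    have := hH.hasPermRank
    apply ext_scal
    rw [scal_comp, scal_ofScalHom hF hH, scal_ofScalHom hH hF, monomial_hadamard,
      mul_inv_cancel, scal_id, hF.rankC]
  inv_hom_id := by
    have := hF.hasPermRank
    have := hH.hasPermRank
    apply ext_scal
    rw [scal_comp, scal_ofScalHom hF hH, scal_ofScalHom hH hF, monomial_hadamard,
      inv_mul_cancel, scal_id, hH.rankC]

theorem scal_ofScal {F H : Mor n n} {σ : Equiv.Perm (Fin n)} (hF : F.IsPerm σ) (hH : H.IsPerm σ)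
    (x : Fin n → ℂˣ) : scal (ofScal hF hH x).hom = monomial x σ :=
  scal_ofScalHom hF hH x

end Mor2

end TwoMatrix

/-! ### Representations in terms of the monoidal category -/

namespace TwoGroup

open TwoMatrix
open scoped CategoryTheory.Pseudofunctor.StrongTrans

universe v u

variable (G : Type u) [Category.{v} G] [MonoidalCategory G]

/-- The data of a representation of dimension `n`, in terms of the monoidal category `G` and of the
composition of 2-matrices in the order of the composition of maps: a form of `Representation`
without the reversed one-object bicategory. -/
structure RepData (n : ℕ) where
  obj : G → Mor n n
  hom {A B : G} (f : A ⟶ B) : obj A ⟶ obj B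
  ten (A B : G) : Mor.comp (obj A) (obj B) ≅ obj (A ⊗ B)
  unit : Mor.one n ≅ obj (𝟙_ G)
  hom_id (A : G) : hom (𝟙 A) = 𝟙 (obj A)
  hom_comp {A B C : G} (f : A ⟶ B) (g : B ⟶ C) : hom (f ≫ g) = hom f ≫ hom g
  hom_whiskerRight {A A' : G} (f : A ⟶ A') (B : G) :
    hom (f ▷ B) = (ten A B).inv ≫ Mor2.hcomp (hom f) (𝟙 (obj B)) ≫ (ten A' B).hom
  hom_whiskerLeft (A : G) {B B' : G} (f : B ⟶ B') :
    hom (A ◁ f) = (ten A B).inv ≫ Mor2.hcomp (𝟙 (obj A)) (hom f) ≫ (ten A B').hom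
  hom_associator_inv (A B C : G) :
    hom (α_ A B C).inv = (ten A (B ⊗ C)).inv ≫ Mor2.hcomp (𝟙 (obj A)) (ten B C).inv ≫
      eqToHom (Mor.comp_assoc _ _ _) ≫ Mor2.hcomp (ten A B).hom (𝟙 (obj C)) ≫
        (ten (A ⊗ B) C).hom
  hom_leftUnitor (A : G) :
    hom (λ_ A).hom = (ten (𝟙_ G) A).inv ≫ Mor2.hcomp unit.inv (𝟙 (obj A)) ≫
      eqToHom (Mor.one_comp _)
  hom_rightUnitor (A : G) :
    hom (ρ_ A).hom = (ten A (𝟙_ G)).inv ≫ Mor2.hcomp (𝟙 (obj A)) unit.inv ≫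
      eqToHom (Mor.comp_one _)

variable {G}

namespace RepData

variable {n : ℕ}

/-- The representation with given data. -/
noncomputable def toRep (R : RepData G n) : Representation G where
  obj _ := ⟨n⟩
  map A := R.obj (MonoidalOpposite.unmop (C := G) A)
  map₂ f := R.hom (MonoidalOpposite.unmop f)
  map₂_id _ := R.hom_id _
  map₂_comp _ _ := R.hom_comp _ _
  mapId _ := R.unit.symm
  mapComp B A := (R.ten (MonoidalOpposite.unmop (C := G) A)
    (MonoidalOpposite.unmop (C := G) B)).symm
  map₂_whisker_left B _ _ f :=
    R.hom_whiskerRight (MonoidalOpposite.unmop f) (MonoidalOpposite.unmop (C := G) B)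
  map₂_whisker_right f A :=
    R.hom_whiskerLeft (MonoidalOpposite.unmop (C := G) A) (MonoidalOpposite.unmop f)
  map₂_associator C B A := R.hom_associator_inv (MonoidalOpposite.unmop (C := G) A)
    (MonoidalOpposite.unmop (C := G) B) (MonoidalOpposite.unmop (C := G) C)
  map₂_left_unitor A := R.hom_rightUnitor (MonoidalOpposite.unmop (C := G) A)
  map₂_right_unitor A := R.hom_leftUnitor (MonoidalOpposite.unmop (C := G) A)

/-- The data of a representation. Both `(ofRep F).toRep = F` and `ofRep R.toRep = R` hold by
definition. -/
noncomputable def ofRep (F : Representation G) : RepData G F.dim where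
  obj := F.onObj
  hom := F.onHom
  ten A B := (F.mapComp (a := MonoidalSingleObj.star Gᴹᵒᵖ) (b := MonoidalSingleObj.star Gᴹᵒᵖ)
    (c := MonoidalSingleObj.star Gᴹᵒᵖ) (MonoidalOpposite.mop B) (MonoidalOpposite.mop A)).symm
  unit := (F.mapId (MonoidalSingleObj.star Gᴹᵒᵖ)).symm
  hom_id A := F.map₂_id (a := MonoidalSingleObj.star Gᴹᵒᵖ) (b := MonoidalSingleObj.star Gᴹᵒᵖ)
    (MonoidalOpposite.mop A)
  hom_comp f g := F.map₂_comp (a := MonoidalSingleObj.star Gᴹᵒᵖ)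
    (b := MonoidalSingleObj.star Gᴹᵒᵖ) f.mop g.mop
  hom_whiskerRight f B :=
    F.map₂_whisker_left (a := MonoidalSingleObj.star Gᴹᵒᵖ) (b := MonoidalSingleObj.star Gᴹᵒᵖ)
      (c := MonoidalSingleObj.star Gᴹᵒᵖ) (MonoidalOpposite.mop B) f.mop
  hom_whiskerLeft A _ _ f :=
    F.map₂_whisker_right (a := MonoidalSingleObj.star Gᴹᵒᵖ) (b := MonoidalSingleObj.star Gᴹᵒᵖ)
      (c := MonoidalSingleObj.star Gᴹᵒᵖ) f.mop (MonoidalOpposite.mop A)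
  hom_associator_inv A B C := F.map₂_associator (a := MonoidalSingleObj.star Gᴹᵒᵖ)
      (b := MonoidalSingleObj.star Gᴹᵒᵖ) (c := MonoidalSingleObj.star Gᴹᵒᵖ)
      (d := MonoidalSingleObj.star Gᴹᵒᵖ)
      (MonoidalOpposite.mop C) (MonoidalOpposite.mop B) (MonoidalOpposite.mop A)
  hom_leftUnitor A := F.map₂_right_unitor (a := MonoidalSingleObj.star Gᴹᵒᵖ)
      (b := MonoidalSingleObj.star Gᴹᵒᵖ) (MonoidalOpposite.mop A)
  hom_rightUnitor A := F.map₂_left_unitor (a := MonoidalSingleObj.star Gᴹᵒᵖ)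
      (b := MonoidalSingleObj.star Gᴹᵒᵖ) (MonoidalOpposite.mop A)

end RepData

/-- Pseudonatural transformations are equal if their 1-morphisms and their naturality
2-isomorphisms are; the latter have the same type only after the former are identified. -/
theorem strongTrans_ext {F F' : Representation G} {ξ η : F ⟶ F'} (h : ξ.app = η.app)
    (h' : ∀ (a b : MonoidalSingleObj Gᴹᵒᵖ) (A : a ⟶ b), HEq (ξ.naturality A) (η.naturality A)) :
    ξ = η := by
  obtain ⟨app, nat, _, _, _⟩ := ξ
  obtain ⟨app', nat', _, _, _⟩ := η
  obtain rfl : app = app' := h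
  congr 1
  funext a b A
  exact eq_of_heq (h' a b A)

end TwoGroup

/-! ### Rank matrices of a representation are permutation matrices -/

namespace TwoMatrix

/-- Invertible matrices of natural numbers are permutation matrices. -/
theorem exists_perm_of_mul_eq_one {n : ℕ} {M N : Matrix (Fin n) (Fin n) ℕ} (hMN : M * N = 1)
    (hNM : N * M = 1) :
    ∃ σ : Equiv.Perm (Fin n), ∀ i j, M i j = if i = σ j then 1 else 0 := by
  have h1 : ∀ i j, ∑ k, N i k * M k j = if i = j then 1 else 0 := fun i j => by
    rw [← Matrix.mul_apply, hNM, Matrix.one_apply]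
  have h2 : ∀ i, ∃ k, N i k ≠ 0 ∧ M k i ≠ 0 := fun i => by
    by_contra! h
    have := h1 i i
    rw [Finset.sum_eq_zero fun k _ => by by_cases hk : N i k = 0 <;> simp [hk, h k]] at this
    simp at this
  choose σ hN hM using h2
  have h3 : ∀ i j, i ≠ j → M (σ i) j = 0 := fun i j hij => by
    have := h1 i j
    rw [if_neg hij, Finset.sum_eq_zero_iff] at this
    exact (mul_eq_zero.1 (this (σ i) (Finset.mem_univ _))).resolve_left (hN i)
  have hinj : Function.Injective σ := fun i j hij => by
    by_contra hne
    exact hM j (hij ▸ h3 i j hne)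
  have h4 : ∀ i, M (σ i) i = 1 := fun i => by
    have h := congrFun (congrFun hMN (σ i)) (σ i)
    rw [Matrix.mul_apply, Finset.sum_eq_single i (fun j _ hj => by rw [h3 i j hj.symm, zero_mul])
      (by simp), Matrix.one_apply_eq] at h
    exact Nat.eq_one_of_mul_eq_one_right h
  refine ⟨Equiv.ofBijective σ (Finite.injective_iff_bijective.1 hinj), fun i j => ?_⟩
  obtain ⟨k, rfl⟩ := Finite.surjective_of_injective hinj i
  by_cases hkj : k = j
  · subst hkj; simp [h4]
  · rw [h3 k j hkj, if_neg]
    exact fun h => hkj (hinj h)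

theorem Mor.rank_eq_of_iso {n m : ℕ} {F H : Mor n m} (T : F ≅ H) : F.rank = H.rank := by
  funext i j
  have h1 : T.inv.entry i j * T.hom.entry i j = 1 :=
    congrFun (congrFun (congrArg Mor2.entry T.hom_inv_id) i) j
  have h2 : T.hom.entry i j * T.inv.entry i j = 1 :=
    congrFun (congrFun (congrArg Mor2.entry T.inv_hom_id) i) j
  simpa using (Matrix.toLin'OfInv h1 h2).finrank_eq

end TwoMatrix

namespace TwoGroup

open TwoMatrix

universe v u

variable {G : Type u} [Category.{v} G] [MonoidalCategory G] [TwoGroup G] {n : ℕ}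

namespace RepData

/-- The 2-isomorphism representing an isomorphism. -/
def mapIso (R : RepData G n) {A B : G} (f : A ≅ B) : R.obj A ≅ R.obj B where
  hom := R.hom f.hom
  inv := R.hom f.inv
  hom_inv_id := by rw [← R.hom_comp, f.hom_inv_id, R.hom_id]
  inv_hom_id := by rw [← R.hom_comp, f.inv_hom_id, R.hom_id]

/-- The rank matrices of a representation, as a homomorphism on isomorphism classes of objects. -/
def rankHom (R : RepData G n) : Pi0 G →* Matrix (Fin n) (Fin n) ℕ where
  toFun := Quotient.lift (s := isIsomorphicSetoid G) (fun A => (R.obj A).rank) fun _ _ ⟨f⟩ =>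
    Mor.rank_eq_of_iso (R.mapIso f)
  map_one' := by
    refine (Mor.rank_eq_of_iso R.unit).symm.trans ?_
    ext i j
    by_cases h : i = j
    · subst h; simp [Mor.one]
    · simp [Mor.one, h]
  map_mul' := by
    rintro ⟨A⟩ ⟨B⟩
    exact (Mor.rank_eq_of_iso (R.ten A B)).symm

theorem exists_perm (R : RepData G n) (g : Pi0 G) : ∃ σ : Equiv.Perm (Fin n),
    ∀ i j, R.rankHom g i j = if i = σ j then 1 else 0 :=
  exists_perm_of_mul_eq_one (N := R.rankHom g⁻¹) (by rw [← map_mul, mul_inv_cancel, map_one])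
    (by rw [← map_mul, inv_mul_cancel, map_one])

/-- The rank matrices of a representation form a homomorphism from the group of isomorphism classes
of objects to the symmetric group. -/
theorem exists_permHom (R : RepData G n) :
    ∃ ρ : Pi0 G →* Equiv.Perm (Fin n), ∀ A, (R.obj A).IsPerm (ρ (cls A)) := by
  choose σ hσ using R.exists_perm
  refine ⟨MonoidHom.mk' σ fun g h => ?_, fun A => hσ (cls A)⟩
  ext1 j
  have h1 : R.rankHom (g * h) (σ g (σ h j)) j = 1 := by
    rw [map_mul, Matrix.mul_apply, Finset.sum_eq_single (σ h j), hσ, hσ, if_pos rfl, if_pos rfl]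
    · intro k _ hk
      rw [hσ h, if_neg hk, mul_zero]
    · simp
  by_contra hne
  rw [hσ, if_neg fun h => hne h.symm] at h1
  exact zero_ne_one h1

end RepData

end TwoGroup

/-! ### The scalars of a representation -/

namespace TwoMatrix

theorem Mor2.scal_ofScal_inv {n : ℕ} {F H : Mor n n} {σ : Equiv.Perm (Fin n)} (hF : F.IsPerm σ)
    (hH : H.IsPerm σ) (x : Fin n → ℂˣ) : scal (ofScal hF hH x).inv = monomial x⁻¹ σ :=
  scal_ofScalHom hH hF x⁻¹

theorem Mor2.scal_inv {n : ℕ} {F H : Mor n n} {σ : Equiv.Perm (Fin n)} (hF : F.IsPerm σ)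
    (hH : H.IsPerm σ) {T : F ≅ H} {x : Fin n → ℂˣ} (h : scal T.hom = monomial x σ) :
    scal T.inv = monomial x⁻¹ σ := by
  have := hF.hasPermRank
  have := hH.hasPermRank
  have : T = ofScal hF hH x := Iso.ext (ext_scal (h.trans (scal_ofScal hF hH x).symm))
  rw [this, scal_ofScal_inv]

end TwoMatrix

namespace TwoGroup

open TwoMatrix Mor2

universe v u

section

variable {G : Type u} [Category.{v} G] [MonoidalCategory G] [TwoGroup G]

theorem map_cls_tensor {M : Type*} [Monoid M] (ρ : Pi0 G →* M) (A B : G) :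
    ρ (cls (A ⊗ B)) = ρ (cls A) * ρ (cls B) := map_mul ρ (cls A) (cls B)

theorem map_cls_unit {M : Type*} [Monoid M] (ρ : Pi0 G →* M) : ρ (cls (𝟙_ G)) = 1 := map_one ρ

theorem cls_eq_of_hom {A B : G} (f : A ⟶ B) : cls A = cls B := cls_eq_iff.2 ⟨asIso f⟩

end

variable (G : Type u) [Category.{v} G] [MonoidalCategory G] [TwoGroup G]

/-- The scalars that describe a representation of dimension `n`: the permutations `ρ` are its rank
matrices, and `hom f`, `ten A B` and `unit` are the nonzero entries of the 2-morphism of `f`, of the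
structural 2-isomorphism of `A` and `B` and of that of the unit object, each listed by the row in
which it stands. The remaining fields are the axioms of a pseudofunctor in terms of these entries,
by `scal_comp` and `scal_hcomp`. -/
structure ScalarRep (n : ℕ) where
  ρ : Pi0 G →* Equiv.Perm (Fin n)
  hom {A B : G} (f : A ⟶ B) : Fin n → ℂˣ
  ten (A B : G) : Fin n → ℂˣ
  unit : Fin n → ℂˣ
  hom_comp {A B C : G} (f : A ⟶ B) (g : B ⟶ C) : hom (f ≫ g) = hom f * hom g
  hom_whiskerRight {A A' : G} (f : A ⟶ A') (B : G) :
    hom (f ▷ B) = (ten A B)⁻¹ * (hom f * ten A' B)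
  hom_whiskerLeft (A : G) {B B' : G} (f : B ⟶ B') :
    hom (A ◁ f) = (ten A B)⁻¹ * (permAction n (ρ (cls A)) (hom f) * ten A B')
  hom_associator_inv (A B C : G) :
    hom (α_ A B C).inv = (ten A (B ⊗ C))⁻¹ * ((permAction n (ρ (cls A)) (ten B C))⁻¹ *
      (ten A B * ten (A ⊗ B) C))
  hom_leftUnitor (A : G) : hom (λ_ A).hom = (ten (𝟙_ G) A)⁻¹ * unit⁻¹
  hom_rightUnitor (A : G) :
    hom (ρ_ A).hom = (ten A (𝟙_ G))⁻¹ * (permAction n (ρ (cls A)) unit)⁻¹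

variable {G} {n : ℕ}

/-- The scalars `D` are the nonzero entries of the 2-morphisms of `R`. -/
structure RepData.Models (R : RepData G n) (D : ScalarRep G n) : Prop where
  obj (A : G) : (R.obj A).IsPerm (D.ρ (cls A))
  hom {A B : G} (f : A ⟶ B) : scal (R.hom f) = monomial (D.hom f) (D.ρ (cls A))
  ten (A B : G) : scal (R.ten A B).hom = monomial (D.ten A B) (D.ρ (cls A) * D.ρ (cls B))
  unit : scal R.unit.hom = monomial D.unit 1

namespace ScalarRep

theorem hom_id (D : ScalarRep G n) (A : G) : D.hom (𝟙 A) = 1 := by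
  have := D.hom_comp (𝟙 A) (𝟙 A)
  rwa [Category.comp_id, left_eq_mul] at this

theorem isPerm_tensor (D : ScalarRep G n) (A B : G) :
    (Mor.perm (D.ρ (cls (A ⊗ B)))).IsPerm (D.ρ (cls A) * D.ρ (cls B)) := by
  rw [map_cls_tensor]
  exact Mor.isPerm_perm _

theorem isPerm_unit (D : ScalarRep G n) : (Mor.perm (D.ρ (cls (𝟙_ G)))).IsPerm 1 := by
  rw [map_cls_unit]
  exact Mor.isPerm_perm _

theorem isPerm_target (D : ScalarRep G n) {A B : G} (f : A ⟶ B) :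
    (Mor.perm (D.ρ (cls B))).IsPerm (D.ρ (cls A)) := by
  rw [cls_eq_of_hom f]
  exact Mor.isPerm_perm _

/-- The representation with given scalars whose 1-morphisms are permutation matrices with the
trivial gauge. -/
noncomputable def toRepData (D : ScalarRep G n) : RepData G n where
  obj A := Mor.perm (D.ρ (cls A))
  hom {A B} f := (ofScal (Mor.isPerm_perm (D.ρ (cls A))) (D.isPerm_target f) (D.hom f)).hom
  ten A B := ofScal ((Mor.isPerm_perm _).comp (Mor.isPerm_perm _)) (D.isPerm_tensor A B)
    (D.ten A B)
  unit := ofScal Mor.isPerm_one D.isPerm_unit D.unit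
  hom_id A := by
    apply ext_scal
    rw [scal_ofScal, scal_id, Mor.rankC_perm, hom_id]
  hom_comp f g := by
    apply ext_scal
    simp only [scal_comp, scal_ofScal, cls_eq_of_hom f, monomial_hadamard, hom_comp]
  hom_whiskerRight f B := by
    apply ext_scal
    simp only [scal_comp, scal_ofScal, scal_hcomp, scal_id, Mor.rankC_perm, scal_ofScal_inv,
      monomial_mul, map_one, mul_one, ← cls_eq_of_hom f, monomial_hadamard, map_cls_tensor,
      hom_whiskerRight]
  hom_whiskerLeft A B B' f := by
    apply ext_scal
    simp only [scal_comp, scal_ofScal, scal_hcomp, scal_id, Mor.rankC_perm, scal_ofScal_inv,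
      monomial_mul, one_mul, ← cls_eq_of_hom f, monomial_hadamard, map_cls_tensor,
      hom_whiskerLeft]
  hom_associator_inv A B C := by
    apply ext_scal
    simp only [scal_comp, scal_ofScal, scal_hcomp, scal_id, scal_eqToHom, Mor.rankC_comp,
      Mor.rankC_perm, scal_ofScal_inv, monomial_mul, one_mul, mul_one, map_one, map_inv, mul_assoc,
      monomial_hadamard, map_cls_tensor, hom_associator_inv]
  hom_leftUnitor A := by
    apply ext_scal
    simp only [scal_comp, scal_ofScal, scal_hcomp, scal_id, scal_eqToHom, Mor.rankC_comp,
      Mor.rankC_perm, Mor.rankC_one, scal_ofScal_inv, monomial_mul, one_mul, mul_one, map_one,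
      monomial_hadamard, map_cls_tensor, map_cls_unit, hom_leftUnitor]
  hom_rightUnitor A := by
    apply ext_scal
    simp only [scal_comp, scal_ofScal, scal_hcomp, scal_id, scal_eqToHom, Mor.rankC_comp,
      Mor.rankC_perm, Mor.rankC_one, scal_ofScal_inv, monomial_mul, one_mul, mul_one, map_one,
      map_inv, monomial_hadamard, map_cls_tensor, map_cls_unit, hom_rightUnitor]

theorem models_toRepData (D : ScalarRep G n) : D.toRepData.Models D where
  obj _ := Mor.isPerm_perm _
  hom f := scal_ofScal (Mor.isPerm_perm _) (D.isPerm_target f) _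
  ten A B := scal_ofScal ((Mor.isPerm_perm _).comp (Mor.isPerm_perm _)) (D.isPerm_tensor A B) _
  unit := scal_ofScal Mor.isPerm_one D.isPerm_unit _

end ScalarRep

/-- Every representation is described by scalars. -/
theorem RepData.exists_models (R : RepData G n) : ∃ D, R.Models D := by
  obtain ⟨ρ, hρ⟩ := R.exists_permHom
  have hT : ∀ A B, (R.obj (A ⊗ B)).IsPerm (ρ (cls A) * ρ (cls B)) := fun A B => by
    rw [← map_cls_tensor]; exact hρ (A ⊗ B)
  have hU : (R.obj (𝟙_ G)).IsPerm 1 := by rw [← map_cls_unit ρ]; exact hρ (𝟙_ G)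
  have hinst : ∀ A, (R.obj A).HasPermRank := fun A => (hρ A).hasPermRank
  have h1 : ∀ {A B : G} (f : A ⟶ B), ∃ x, scal (R.hom f) = monomial x (ρ (cls A)) := fun {A B} f =>
    exists_scal (hρ A) (by rw [cls_eq_of_hom f]; exact hρ B) (R.mapIso (asIso f))
  have h2 : ∀ A B : G, ∃ x, scal (R.ten A B).hom = monomial x (ρ (cls A) * ρ (cls B)) :=
    fun A B => exists_scal ((hρ A).comp (hρ B)) (hT A B) (R.ten A B)
  choose x hx using @h1
  choose t ht using h2
  obtain ⟨e, he⟩ := exists_scal Mor.isPerm_one hU R.unit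
  have ht' := fun A B => scal_inv ((hρ A).comp (hρ B)) (hT A B) (ht A B)
  have he' := scal_inv Mor.isPerm_one hU he
  have hr := fun A => (hρ A).rankC
  refine ⟨{ ρ := ρ, hom := x, ten := t, unit := e, hom_comp := ?_, hom_whiskerRight := ?_,
            hom_whiskerLeft := ?_, hom_associator_inv := ?_, hom_leftUnitor := ?_,
            hom_rightUnitor := ?_ }, ⟨hρ, hx, ht, he⟩⟩
  · intro A B C f g
    have h := congrArg scal (R.hom_comp f g)
    simp only [scal_comp, hx, ← cls_eq_of_hom f, monomial_hadamard] at h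
    exact (monomial_injective h).1
  · intro A A' f B
    have h := congrArg scal (R.hom_whiskerRight f B)
    simp only [scal_comp, scal_hcomp, scal_id, hx, ht, ht', hr, ← cls_eq_of_hom f, monomial_mul,
      map_one, mul_one, monomial_hadamard] at h
    exact (monomial_injective h).1
  · intro A B B' f
    have h := congrArg scal (R.hom_whiskerLeft A f)
    simp only [scal_comp, scal_hcomp, scal_id, hx, ht, ht', hr, ← cls_eq_of_hom f, monomial_mul,
      one_mul, monomial_hadamard] at h
    exact (monomial_injective h).1
  · intro A B C
    have h := congrArg scal (R.hom_associator_inv A B C)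
    simp only [scal_comp, scal_hcomp, scal_id, scal_eqToHom, Mor.rankC_comp, hx, ht, ht', hr,
      monomial_mul, one_mul, mul_one, map_one, map_inv, mul_assoc, map_cls_tensor,
      monomial_hadamard] at h
    exact (monomial_injective h).1
  · intro A
    have h := congrArg scal (R.hom_leftUnitor A)
    simp only [scal_comp, scal_hcomp, scal_id, scal_eqToHom, Mor.rankC_comp, Mor.rankC_one, hx,
      ht', he', hr, monomial_mul, one_mul, mul_one, map_one, map_cls_tensor, map_cls_unit,
      monomial_hadamard] at h
    exact (monomial_injective h).1
  · intro A
    have h := congrArg scal (R.hom_rightUnitor A)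
    simp only [scal_comp, scal_hcomp, scal_id, scal_eqToHom, Mor.rankC_comp, Mor.rankC_one, hx,
      ht', he', hr, monomial_mul, one_mul, mul_one, map_one, map_inv, map_cls_tensor,
      map_cls_unit, monomial_hadamard] at h
    exact (monomial_injective h).1

end TwoGroup

/-! ### Strictly invertible transformations whose 1-morphism is the identity -/

namespace TwoMatrix.Mor2

variable {n : ℕ}

theorem scal_eqToHom_comp {F F' H : Mor n n} (h : F = F') (T : F' ⟶ H) :
    scal (eqToHom h ≫ T) = scal T := by
  subst h; rw [eqToHom_refl, Category.id_comp]

theorem scal_comp_eqToHom {F H H' : Mor n n} (T : F ⟶ H) (h : H = H') :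
    scal (T ≫ eqToHom h) = scal T := by
  subst h; rw [eqToHom_refl, Category.comp_id]

theorem scal_hcomp_one {F F' : Mor n n} (T : F ⟶ F') :
    scal (hcomp T (𝟙 (Mor.one n))) = scal T := by
  rw [scal_hcomp, scal_id, Mor.rankC_one_eq, Matrix.mul_one]

theorem scal_one_hcomp {F F' : Mor n n} [F.HasPermRank] [F'.HasPermRank] (T : F ⟶ F') :
    scal (hcomp (𝟙 (Mor.one n)) T) = scal T := by
  rw [scal_hcomp, scal_id, Mor.rankC_one_eq, Matrix.one_mul]

end TwoMatrix.Mor2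

namespace TwoGroup

open TwoMatrix Mor2
open scoped CategoryTheory.Pseudofunctor.StrongTrans

universe v u

variable {G : Type u} [Category.{v} G] [MonoidalCategory G] {n : ℕ}

/-- The natural monoidal isomorphisms between two representations: the data of a pseudonatural
transformation whose 1-morphism is the identity, without the identifications of `F` with its
composites with the identity. -/
structure RepData.Iso (R R' : RepData G n) where
  app (A : G) : R.obj A ≅ R'.obj A
  naturality {A B : G} (f : A ⟶ B) : R.hom f ≫ (app B).hom = (app A).hom ≫ R'.hom f
  tensor (A B : G) : (app (A ⊗ B)).hom ≫ (R'.ten A B).inv =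
    (R.ten A B).inv ≫ hcomp (app A).hom (𝟙 (R.obj B)) ≫ hcomp (𝟙 (R'.obj A)) (app B).hom
  unit : (app (𝟙_ G)).hom ≫ R'.unit.inv = R.unit.inv

namespace RepData.Iso

variable {R R' : RepData G n}

theorem unit_transformation (y : R.Iso R') [∀ A, (R.obj A).HasPermRank]
    [∀ A, (R'.obj A).HasPermRank] :
    (eqToHom (Mor.one_comp _) ≫ (y.app (𝟙_ G)).hom ≫ eqToHom (Mor.comp_one _).symm) ≫
      hcomp R'.unit.inv (𝟙 (Mor.one n)) = hcomp (𝟙 (Mor.one n)) R.unit.inv ≫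
        eqToHom (Mor.comp_one _) ≫ eqToHom (Mor.one_comp _).symm := by
  apply ext_scal
  rw [scal_comp, scal_eqToHom_comp, scal_comp_eqToHom, scal_hcomp_one, ← scal_comp, y.unit,
    eqToHom_trans, scal_comp_eqToHom, scal_one_hcomp]

theorem naturality_transformation (y : R.Iso R') [∀ A, (R.obj A).HasPermRank]
    [∀ A, (R'.obj A).HasPermRank] {A B : G} (f : A ⟶ B) :
    hcomp (𝟙 (Mor.one n)) (R.hom f) ≫
      eqToHom (Mor.one_comp _) ≫ (y.app B).hom ≫ eqToHom (Mor.comp_one _).symm =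
    (eqToHom (Mor.one_comp _) ≫ (y.app A).hom ≫ eqToHom (Mor.comp_one _).symm) ≫
      hcomp (R'.hom f) (𝟙 (Mor.one n)) := by
  apply ext_scal
  rw [scal_comp, scal_eqToHom_comp, scal_comp_eqToHom, scal_one_hcomp, ← scal_comp, y.naturality,
    scal_comp, scal_comp, scal_eqToHom_comp, scal_comp_eqToHom, scal_hcomp_one]

theorem tensor_transformation (y : R.Iso R') [∀ A, (R.obj A).HasPermRank]
    [∀ A, (R'.obj A).HasPermRank] (A B : G) :
    (eqToHom (Mor.one_comp _) ≫ (y.app (A ⊗ B)).hom ≫ eqToHom (Mor.comp_one _).symm) ≫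
      hcomp (R'.ten A B).inv (𝟙 (Mor.one n)) =
    hcomp (𝟙 (Mor.one n)) (R.ten A B).inv ≫ eqToHom (Mor.comp_assoc _ _ _) ≫
      hcomp (eqToHom (Mor.one_comp _) ≫ (y.app A).hom ≫ eqToHom (Mor.comp_one _).symm)
        (𝟙 (R.obj B)) ≫ eqToHom (Mor.comp_assoc _ _ _).symm ≫
      hcomp (𝟙 (R'.obj A))
        (eqToHom (Mor.one_comp _) ≫ (y.app B).hom ≫ eqToHom (Mor.comp_one _).symm) ≫
      eqToHom (Mor.comp_assoc _ _ _) := by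
  have h := congrArg scal (y.tensor A B)
  simp only [scal_comp, scal_hcomp] at h
  apply ext_scal
  simp only [↓scal_eqToHom_comp, ↓scal_comp_eqToHom, ↓scal_hcomp_one, ↓scal_one_hcomp, scal_comp,
    scal_hcomp, h]

/-- The transformation whose 1-morphism is the identity and whose 2-morphisms are the given ones. -/
noncomputable def toHom (y : R.Iso R') [∀ A, (R.obj A).HasPermRank]
    [∀ A, (R'.obj A).HasPermRank] : R.toRep ⟶ R'.toRep where
  app _ := Mor.one n
  naturality A := eqToIso (Mor.one_comp _) ≪≫ y.app (MonoidalOpposite.unmop (C := G) A) ≪≫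
    eqToIso (Mor.comp_one _).symm
  naturality_naturality f := y.naturality_transformation (MonoidalOpposite.unmop f)
  naturality_id _ := y.unit_transformation
  naturality_comp B A := y.tensor_transformation (MonoidalOpposite.unmop (C := G) A)
    (MonoidalOpposite.unmop (C := G) B)

theorem toHom_comp_toHom (y : R.Iso R') (z : R'.Iso R) [∀ A, (R.obj A).HasPermRank]
    [∀ A, (R'.obj A).HasPermRank] (h : ∀ A, (y.app A).hom ≫ (z.app A).hom = 𝟙 _) :
    y.toHom ≫ z.toHom = 𝟙 R.toRep := by
  apply strongTrans_ext
  · funext a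
    exact Mor.comp_one (Mor.one n)
  · intro a b A
    let X := R.obj (MonoidalOpposite.unmop (C := G) A)
    let Y := R'.obj (MonoidalOpposite.unmop (C := G) A)
    let p := y.app (MonoidalOpposite.unmop (C := G) A)
    let q := z.app (MonoidalOpposite.unmop (C := G) A)
    -- The naturality 2-isomorphisms at `A` of the composite and of the identity.
    refine heq_of_scal (F := Mor.comp (Mor.comp (Mor.one n) (Mor.one n)) X)
      (H := Mor.comp X (Mor.comp (Mor.one n) (Mor.one n)))
      (F' := Mor.comp (Mor.one n) X) (H' := Mor.comp X (Mor.one n))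
      (by rw [Mor.comp_one]) (by rw [Mor.comp_one]) ?_
    have h' : scal (eqToHom (Mor.comp_assoc (Mor.one n) (Mor.one n) X).symm ≫
        hcomp (𝟙 (Mor.one n))
          (eqToHom (Mor.one_comp X) ≫ p.hom ≫ eqToHom (Mor.comp_one Y).symm) ≫
        eqToHom (Mor.comp_assoc (Mor.one n) Y (Mor.one n)) ≫
        hcomp (eqToHom (Mor.one_comp Y) ≫ q.hom ≫ eqToHom (Mor.comp_one X).symm)
          (𝟙 (Mor.one n)) ≫ eqToHom (Mor.comp_assoc X (Mor.one n) (Mor.one n)).symm) =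
        scal (eqToHom (Mor.one_comp X) ≫ eqToHom (Mor.comp_one X).symm) := by
      have h' := congrArg scal (h (MonoidalOpposite.unmop (C := G) A))
      rw [scal_comp, scal_id] at h'
      simp only [↓scal_eqToHom_comp, ↓scal_comp_eqToHom, ↓scal_hcomp_one, ↓scal_one_hcomp,
        scal_comp, scal_eqToHom, Mor.rankC_comp, Mor.rankC_one_eq, Matrix.one_mul, h', p, q, X, Y]
    exact h'

/-- The transformations of mutually inverse natural isomorphisms are strictly inverse, as the
identity 1-morphism composes strictly. -/
theorem isomorphic (y : R.Iso R') (z : R'.Iso R) [∀ A, (R.obj A).HasPermRank]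
    [∀ A, (R'.obj A).HasPermRank] (h : ∀ A, (y.app A).hom ≫ (z.app A).hom = 𝟙 _) :
    R.toRep.Isomorphic R'.toRep :=
  ⟨y.toHom, z.toHom, y.toHom_comp_toHom z h, z.toHom_comp_toHom y fun A => by
    rw [← cancel_epi (y.app A).hom, reassoc_of% (h A), Category.comp_id]⟩

end RepData.Iso

end TwoGroup

/-! ### Changes of bases -/

namespace TwoGroup

open TwoMatrix Mor2

universe v u

variable {G : Type u} [Category.{v} G] [MonoidalCategory G] [TwoGroup G] {n : ℕ}

namespace ScalarRep

/-- Two families of scalars differ by a change of the bases of the entries of the 1-morphisms, by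
the factors `x A` for the 1-morphism of `A`. -/
structure IsGauge (D D' : ScalarRep G n) (x : G → Fin n → ℂˣ) : Prop where
  ρ : D'.ρ = D.ρ
  hom {A B : G} (f : A ⟶ B) : D.hom f * x B = x A * D'.hom f
  ten (A B : G) : x (A ⊗ B) * (D'.ten A B)⁻¹ =
    (D.ten A B)⁻¹ * (x A * permAction n (D.ρ (cls A)) (x B))
  unit : x (𝟙_ G) * D'.unit⁻¹ = D.unit⁻¹

theorem IsGauge.symm {D D' : ScalarRep G n} {x : G → Fin n → ℂˣ} (h : D.IsGauge D' x) :
    D'.IsGauge D x⁻¹ where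
  ρ := h.ρ.symm
  hom {A B} f := by
    change D'.hom f * (x B)⁻¹ = (x A)⁻¹ * D.hom f
    rw [mul_inv_eq_iff_eq_mul, mul_assoc, h.hom, inv_mul_cancel_left]
  ten A B := by
    have h' := h.ten A B
    change (x (A ⊗ B))⁻¹ * _ = _ * ((x A)⁻¹ * permAction n (D'.ρ (cls A)) (x B)⁻¹)
    rw [h.ρ, map_inv]
    generalize permAction n (D.ρ (cls A)) (x B) = z at *
    apply Additive.ofMul.injective
    replace h' := congrArg Additive.ofMul h'
    simp only [ofMul_mul, ofMul_inv] at *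
    grind
  unit := by
    change (x (𝟙_ G))⁻¹ * _ = _
    rw [← h.unit, inv_mul_cancel_left]

theorem IsGauge.trans {D D' D'' : ScalarRep G n} {x y : G → Fin n → ℂˣ} (h : D.IsGauge D' x)
    (h' : D'.IsGauge D'' y) : D.IsGauge D'' (x * y) where
  ρ := h'.ρ.trans h.ρ
  hom {A B} f := by
    change D.hom f * (x B * y B) = x A * y A * D''.hom f
    rw [← mul_assoc, h.hom, mul_assoc, h'.hom, mul_assoc]
  ten A B := by
    have h1 := h.ten A B
    have h2 := h'.ten A B
    change x (A ⊗ B) * y (A ⊗ B) * _ = _ * (x A * y A * permAction n _ (x B * y B))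
    rw [h.ρ] at h2
    rw [map_mul]
    generalize permAction n (D.ρ (cls A)) (x B) = z at *
    generalize permAction n (D.ρ (cls A)) (y B) = z' at *
    apply Additive.ofMul.injective
    replace h1 := congrArg Additive.ofMul h1
    replace h2 := congrArg Additive.ofMul h2
    simp only [ofMul_mul, ofMul_inv] at *
    grind
  unit := by
    change x (𝟙_ G) * y (𝟙_ G) * _ = _
    rw [mul_assoc, h'.unit, h.unit]

end ScalarRep

namespace RepData.Models

variable {R R' : RepData G n} {D D' : ScalarRep G n}

theorem ten_inv (h : R.Models D) (A B : G) :
    scal (R.ten A B).inv = monomial (D.ten A B)⁻¹ (D.ρ (cls A) * D.ρ (cls B)) :=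
  scal_inv ((h.obj A).comp (h.obj B)) (by rw [← map_cls_tensor]; exact h.obj (A ⊗ B)) (h.ten A B)

theorem unit_inv (h : R.Models D) : scal R.unit.inv = monomial D.unit⁻¹ 1 :=
  scal_inv Mor.isPerm_one (by rw [← map_cls_unit D.ρ]; exact h.obj (𝟙_ G)) h.unit

/-- A change of bases defines an isomorphism of representations. -/
noncomputable def iso (h : R.Models D) (h' : R'.Models D') {x : G → Fin n → ℂˣ}
    (hx : D.IsGauge D' x) : R.Iso R' :=
  have : ∀ A, (R.obj A).HasPermRank := fun A => (h.obj A).hasPermRank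
  have : ∀ A, (R'.obj A).HasPermRank := fun A => (h'.obj A).hasPermRank
  have hobj : ∀ A, (R'.obj A).IsPerm (D.ρ (cls A)) := fun A => hx.ρ ▸ h'.obj A
  { app A := ofScal (h.obj A) (hobj A) (x A)
    naturality f := by
      apply ext_scal
      simp only [scal_comp, scal_ofScal, h.hom, h'.hom, hx.ρ, ← cls_eq_of_hom f,
        monomial_hadamard, hx.hom]
    tensor A B := by
      apply ext_scal
      simp only [scal_comp, scal_hcomp, scal_id, (h.obj _).rankC, (hobj _).rankC, scal_ofScal,
        h.ten_inv, h'.ten_inv, hx.ρ, map_cls_tensor, monomial_mul, monomial_hadamard, map_one,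
        mul_one, one_mul, hx.ten]
    unit := by
      apply ext_scal
      simp only [scal_comp, scal_ofScal, h.unit_inv, h'.unit_inv, map_cls_unit,
        monomial_hadamard, hx.unit] }

theorem isomorphic (h : R.Models D) (h' : R'.Models D') {x : G → Fin n → ℂˣ}
    (hx : D.IsGauge D' x) : R.toRep.Isomorphic R'.toRep := by
  have : ∀ A, (R.obj A).HasPermRank := fun A => (h.obj A).hasPermRank
  have : ∀ A, (R'.obj A).HasPermRank := fun A => (h'.obj A).hasPermRank
  -- The changes of bases by `x` and by `x⁻¹` are mutually inverse.
  refine (h.iso h' hx).isomorphic (h'.iso h hx.symm) fun A => ?_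
  apply ext_scal
  have hobj : (R'.obj A).IsPerm (D.ρ (cls A)) := hx.ρ ▸ h'.obj A
  have hobj' : (R.obj A).IsPerm (D'.ρ (cls A)) := hx.ρ.symm ▸ h.obj A
  have h1 : scal ((h.iso h' hx).app A).hom = monomial (x A) (D.ρ (cls A)) :=
    scal_ofScal (h.obj A) hobj _
  have h2 : scal ((h'.iso h hx.symm).app A).hom = monomial (x A)⁻¹ (D'.ρ (cls A)) :=
    scal_ofScal (h'.obj A) hobj' _
  rw [scal_comp, h1, h2, hx.ρ, monomial_hadamard, mul_inv_cancel, scal_id, (h.obj A).rankC]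

end RepData.Models

end TwoGroup

/-! ### Deviations from the chosen representatives -/

namespace TwoGroup

universe v u

variable {G : Type u} [Category.{v} G] [MonoidalCategory G] [TwoGroup G]

/-- The element `u` of `π₁` by which two parallel morphisms differ: `f = f' ∘ γ(u)`. All morphisms
are invertible, and `γ` is bijective. -/
noncomputable def diff {A B : G} (f f' : A ⟶ B) : Pi1 G :=
  (gammaEquiv A).symm (show Aut A from asIso f ≪≫ (asIso f').symm)

theorem gamma_diff {A B : G} (f f' : A ⟶ B) : (gamma A (diff f f')).hom ≫ f' = f := by
  rw [diff, gamma_symm]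
  exact (Category.assoc _ _ _).trans (by simp)

theorem diff_eq {A B : G} {f f' : A ⟶ B} {u : Pi1 G} (h : (gamma A u).hom ≫ f' = f) :
    diff f f' = u := by
  apply (gamma_bijective A).1
  apply Aut.ext
  rw [← cancel_mono f', gamma_diff, h]

theorem diff_self {A B : G} (f : A ⟶ B) : diff f f = 1 :=
  diff_eq (by rw [map_one]; exact Category.id_comp f)

theorem diff_mul_diff {A B : G} (f f' f'' : A ⟶ B) : diff f f' * diff f' f'' = diff f f'' := by
  refine (diff_eq ?_).symm
  rw [mul_comm, map_mul, mul_hom, Category.assoc, gamma_diff, gamma_diff]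

theorem diff_comp {A B C : G} (f f' : A ⟶ B) (g g' : B ⟶ C) :
    diff (f ≫ g) (f' ≫ g') = diff f f' * diff g g' := by
  apply diff_eq
  rw [map_mul, mul_hom, Category.assoc, ← Category.assoc _ f' g', gamma_diff,
    ← Category.assoc, ← gamma_naturality, Category.assoc, gamma_diff]

theorem diff_comp_left {A B C : G} (f : A ⟶ B) (g g' : B ⟶ C) :
    diff (f ≫ g) (f ≫ g') = diff g g' := by
  rw [diff_comp, diff_self, one_mul]

theorem diff_comp_right {A B C : G} (f f' : A ⟶ B) (g : B ⟶ C) :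
    diff (f ≫ g) (f' ≫ g) = diff f f' := by
  rw [diff_comp, diff_self, mul_one]

theorem diff_whiskerRight {A B : G} (f f' : A ⟶ B) (C : G) :
    diff (f ▷ C) (f' ▷ C) = diff f f' := by
  apply diff_eq
  rw [gamma_tensor, ← comp_whiskerRight, gamma_diff]

theorem diff_whiskerLeft (A : G) {B C : G} (f f' : B ⟶ C) :
    diff (A ◁ f) (A ◁ f') = cls A • diff f f' := by
  apply diff_eq
  change (gamma (A ⊗ B) (act A (diff f f'))).hom ≫ _ = _
  rw [gamma_tensor, gamma_act, ← whisker_gamma, ← whiskerLeft_comp, gamma_diff]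

namespace Transversal

variable (S : Transversal G)

theorem nonempty_iso (A : G) : Nonempty (A ≅ S.obj (cls A)) :=
  cls_eq_iff.1 (S.cls_obj (cls A)).symm

open Classical in
/-- An isomorphism from each object to the representative of its class, the identity if the object
is a representative. -/
noncomputable def toObj (A : G) : A ≅ S.obj (cls A) :=
  if h : A = S.obj (cls A) then eqToIso h else (S.nonempty_iso A).some

theorem toObj_hom {A : G} (h : A = S.obj (cls A)) : (S.toObj A).hom = eqToHom h := by
  rw [toObj, dif_pos h]; rfl

theorem eqToHom_mu {g g' h h' : Pi0 G} (hg : g = g') (hh : h = h') :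
    (S.mu g h).hom ≫ eqToHom (by rw [hg, hh]) =
      eqToHom (by rw [hg]) ▷ S.obj h ≫ S.obj g' ◁ eqToHom (by rw [hh]) ≫ (S.mu g' h').hom := by
  subst hg hh; simp

/-- The deviation of a morphism from the identification of its source and target with the same
representative. -/
noncomputable def dev {A B : G} (f : A ⟶ B) : Pi1 G :=
  diff (f ≫ (S.toObj B).hom) ((S.toObj A).hom ≫ eqToHom (by rw [cls_eq_of_hom f]))

/-- The isomorphism from `A ⊗ B` to the representative of its class that is induced by the choices
for `A` and for `B`. -/
noncomputable def tensorToObj (A B : G) : A ⊗ B ⟶ S.obj (cls A * cls B) :=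
  (S.toObj A).hom ▷ B ≫ S.obj (cls A) ◁ (S.toObj B).hom ≫ (S.mu (cls A) (cls B)).hom

theorem tensorToObj_eq (A B : G) : S.tensorToObj A B =
    A ◁ (S.toObj B).hom ≫ (S.toObj A).hom ▷ S.obj (cls B) ≫ (S.mu (cls A) (cls B)).hom := by
  rw [tensorToObj, whisker_exchange_assoc]

/-- The isomorphism from `A ⊗ B` to the representative of its class, with the target in the form of
that of `tensorToObj`. -/
noncomputable def toObjTensor (A B : G) : A ⊗ B ⟶ S.obj (cls A * cls B) := (S.toObj (A ⊗ B)).hom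

/-- The deviation of the choice for `A ⊗ B` from the choices for `A` and for `B`. -/
noncomputable def tensorDev (A B : G) : Pi1 G :=
  diff (S.tensorToObj A B) (S.toObjTensor A B)

theorem dev_comp {A B C : G} (f : A ⟶ B) (g : B ⟶ C) : S.dev (f ≫ g) = S.dev f * S.dev g := by
  have h1 : S.dev g = diff (f ≫ g ≫ (S.toObj C).hom)
      (f ≫ (S.toObj B).hom ≫ eqToHom (by rw [cls_eq_of_hom g])) := by
    rw [dev, diff_comp_left]
  have h2 : S.dev f = diff (f ≫ (S.toObj B).hom ≫ eqToHom (by rw [cls_eq_of_hom g]))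
      ((S.toObj A).hom ≫ eqToHom (by rw [cls_eq_of_hom f]) ≫
        eqToHom (show S.obj (cls B) = S.obj (cls C) by rw [cls_eq_of_hom g])) := by
    rw [dev, ← Category.assoc, ← Category.assoc, diff_comp_right]
  rw [h1, h2, mul_comm, diff_mul_diff, dev, eqToHom_trans, Category.assoc]

theorem dev_whiskerRight {A A' : G} (f : A ⟶ A') (B : G) :
    S.tensorDev A' B * S.dev (f ▷ B) = S.dev f * S.tensorDev A B := by
  have hc := cls_eq_of_hom f
  have h1 : S.dev f = diff (f ▷ B ≫ S.tensorToObj A' B)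
      (S.tensorToObj A B ≫ eqToHom (by rw [hc])) := by
    have h : S.tensorToObj A B ≫ eqToHom (by rw [hc]) =
        ((S.toObj A).hom ≫ eqToHom (by rw [hc])) ▷ B ≫
          S.obj (cls A') ◁ (S.toObj B).hom ≫ (S.mu (cls A') (cls B)).hom := by
      simp only [tensorToObj, Category.assoc, S.eqToHom_mu hc rfl, eqToHom_refl,
        whiskerLeft_id, Category.id_comp, comp_whiskerRight, whisker_exchange_assoc]
    rw [h, tensorToObj, ← comp_whiskerRight_assoc, diff_comp_right, diff_whiskerRight, dev]
  have h2 : S.tensorDev A B = diff (S.tensorToObj A B ≫ eqToHom (by rw [hc]))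
      (S.toObjTensor A B ≫ eqToHom (show S.obj (cls A * cls B) = S.obj (cls A' * cls B) by
        rw [hc])) := by
    rw [diff_comp_right, tensorDev]
  have h3 : S.tensorDev A' B = diff (f ▷ B ≫ S.tensorToObj A' B)
      (f ▷ B ≫ S.toObjTensor A' B) := by
    rw [diff_comp_left, tensorDev]
  rw [h1, h2, h3, diff_mul_diff]
  exact diff_mul_diff _ _ _

theorem dev_whiskerLeft (A : G) {B B' : G} (f : B ⟶ B') :
    S.tensorDev A B' * S.dev (A ◁ f) = cls A • S.dev f * S.tensorDev A B := by
  have hc := cls_eq_of_hom f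
  have h1 : cls A • S.dev f = diff (A ◁ f ≫ S.tensorToObj A B')
      (S.tensorToObj A B ≫ eqToHom (by rw [hc])) := by
    have h : S.tensorToObj A B ≫ eqToHom (by rw [hc]) =
        A ◁ ((S.toObj B).hom ≫ eqToHom (by rw [hc])) ≫
          (S.toObj A).hom ▷ S.obj (cls B') ≫ (S.mu (cls A) (cls B')).hom := by
      simp only [tensorToObj_eq, Category.assoc, S.eqToHom_mu rfl hc, eqToHom_refl,
        id_whiskerRight, Category.id_comp, MonoidalCategory.whiskerLeft_comp,
        whisker_exchange_assoc]
    rw [h, tensorToObj_eq, ← whiskerLeft_comp_assoc, diff_comp_right, diff_whiskerLeft, dev]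
  have h2 : S.tensorDev A B = diff (S.tensorToObj A B ≫ eqToHom (by rw [hc]))
      (S.toObjTensor A B ≫ eqToHom (show S.obj (cls A * cls B) = S.obj (cls A * cls B') by
        rw [hc])) := by
    rw [diff_comp_right, tensorDev]
  have h3 : S.tensorDev A B' = diff (A ◁ f ≫ S.tensorToObj A B')
      (A ◁ f ≫ S.toObjTensor A B') := by
    rw [diff_comp_left, tensorDev]
  rw [h1, h2, h3, diff_mul_diff]
  exact diff_mul_diff _ _ _

/-- The two isomorphisms from a threefold tensor product to the representative of its class differ
by the classifying cocycle. -/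
theorem tensorToObj_assoc {α : Cochain.Cocycle3 (piAction G)} (hα : IsClassifying S α)
    (A B C : G) :
    S.tensorToObj A B ▷ C ≫ S.obj (cls A * cls B) ◁ (S.toObj C).hom ≫
      (S.mu (cls A * cls B) (cls C)).hom ≫
        (gamma (S.obj _) (α.val (cls A) (cls B) (cls C))).hom =
    (α_ A B C).hom ≫ A ◁ S.tensorToObj B C ≫ (S.toObj A).hom ▷ S.obj (cls B * cls C) ≫
      (S.mu (cls A) (cls B * cls C)).hom ≫ eqToHom (by rw [mul_assoc]) := by
  rw [hα, assoc, tensorToObj, tensorToObj]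
  simp only [comp_whiskerRight, Category.assoc]
  rw [← whisker_exchange_assoc, Iso.hom_inv_id_assoc, hom_inv_whiskerRight_assoc,
    whisker_exchange_assoc]
  simp

/-- The deviation of the associator from the classifying cocycle is the coboundary of
`tensorDev`. -/
theorem dev_associator_inv {α : Cochain.Cocycle3 (piAction G)} (hα : IsClassifying S α)
    (A B C : G) :
    S.dev (α_ A B C).inv * α.val (cls A) (cls B) (cls C) *
        (S.tensorDev A B * S.tensorDev (A ⊗ B) C) =
      cls A • S.tensorDev B C * S.tensorDev A (B ⊗ C) := by
  let g := cls A
  let h := cls B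
  let k := cls C
  let x : (A ⊗ B) ⊗ C ⟶ S.obj (g * h * k) := S.toObjTensor (A ⊗ B) C
  let y : A ⊗ B ⊗ C ⟶ S.obj (g * (h * k)) := S.toObjTensor A (B ⊗ C)
  let L : (A ⊗ B) ⊗ C ⟶ S.obj (g * h * k) :=
    S.tensorToObj A B ▷ C ≫ S.obj (g * h) ◁ (S.toObj C).hom ≫ (S.mu (g * h) k).hom
  -- In `L'` and `R'`, the choice for the inner tensor product replaces the choices for its factors.
  let L' : (A ⊗ B) ⊗ C ⟶ S.obj (g * h * k) :=
    S.toObjTensor A B ▷ C ≫ S.obj (g * h) ◁ (S.toObj C).hom ≫ (S.mu (g * h) k).hom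
  let R : A ⊗ B ⊗ C ⟶ S.obj (g * (h * k)) :=
    A ◁ S.tensorToObj B C ≫ (S.toObj A).hom ▷ S.obj (h * k) ≫ (S.mu g (h * k)).hom
  let R' : A ⊗ B ⊗ C ⟶ S.obj (g * (h * k)) :=
    A ◁ S.toObjTensor B C ≫ (S.toObj A).hom ▷ S.obj (h * k) ≫ (S.mu g (h * k)).hom
  have e : S.obj (g * (h * k)) = S.obj (g * h * k) := by rw [mul_assoc]
  have hL : S.tensorDev A B * S.tensorDev (A ⊗ B) C = diff L x := by
    have h1 : S.tensorDev A B = diff L L' := by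
      rw [diff_comp_right, diff_whiskerRight, tensorDev]
    have h2 : S.tensorDev (A ⊗ B) C = diff L' x := rfl
    rw [h1, h2, diff_mul_diff]
  have hR : cls A • S.tensorDev B C * S.tensorDev A (B ⊗ C) = diff R y := by
    have h1 : cls A • S.tensorDev B C = diff R R' := by
      rw [diff_comp_right, diff_whiskerLeft, tensorDev]
    have h2 : S.tensorDev A (B ⊗ C) = diff R' y := by
      rw [tensorDev, tensorToObj_eq]; rfl
    rw [h1, h2, diff_mul_diff]
  have hdev : S.dev (α_ A B C).inv = diff ((α_ A B C).inv ≫ x) (y ≫ eqToHom e) := rfl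
  have hLR : diff (R ≫ eqToHom e) ((α_ A B C).inv ≫ L) = α.val g h k := by
    apply diff_eq
    rw [← gamma_naturality]
    simp only [Category.assoc]
    rw [Iso.inv_comp_eq]
    simpa only [L, R, Category.assoc] using S.tensorToObj_assoc hα A B C
  rw [hL, hR, hdev, ← hLR, ← diff_comp_right R y (eqToHom e),
    ← diff_comp_left (α_ A B C).inv L x,
    ← diff_mul_diff (R ≫ eqToHom e) ((α_ A B C).inv ≫ L) (y ≫ eqToHom e),
    ← diff_mul_diff ((α_ A B C).inv ≫ L) ((α_ A B C).inv ≫ x) (y ≫ eqToHom e)]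
  ac_rfl

theorem dev_leftUnitor (A : G) : S.dev (λ_ A).hom = S.tensorDev (𝟙_ G) A := by
  have e : S.obj (1 * cls A) = S.obj (cls A) := by rw [one_mul]
  have h : S.tensorToObj (𝟙_ G) A ≫ eqToHom e = (λ_ A).hom ≫ (S.toObj A).hom := by
    have h1 : S.tensorToObj (𝟙_ G) A = 𝟙_ G ◁ (S.toObj A).hom ≫
        (S.toObj (𝟙_ G)).hom ▷ S.obj (cls A) ≫ (S.mu 1 (cls A)).hom := S.tensorToObj_eq _ _
    rw [h1, S.mu_one_left, S.toObj_hom S.obj_one.symm]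
    simp
  have hdev : S.dev (λ_ A).hom =
      diff ((λ_ A).hom ≫ (S.toObj A).hom) (S.toObjTensor (𝟙_ G) A ≫ eqToHom e) := rfl
  rw [hdev, ← h, diff_comp_right]
  rfl

theorem dev_rightUnitor (A : G) : S.dev (ρ_ A).hom = S.tensorDev A (𝟙_ G) := by
  have e : S.obj (cls A * 1) = S.obj (cls A) := by rw [mul_one]
  have h : S.tensorToObj A (𝟙_ G) ≫ eqToHom e = (ρ_ A).hom ≫ (S.toObj A).hom := by
    have h1 : S.tensorToObj A (𝟙_ G) = (S.toObj A).hom ▷ 𝟙_ G ≫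
        S.obj (cls A) ◁ (S.toObj (𝟙_ G)).hom ≫ (S.mu (cls A) 1).hom := rfl
    rw [h1, S.mu_one_right, S.toObj_hom S.obj_one.symm]
    simp
  have hdev : S.dev (ρ_ A).hom =
      diff ((ρ_ A).hom ≫ (S.toObj A).hom) (S.toObjTensor A (𝟙_ G) ≫ eqToHom e) := rfl
  rw [hdev, ← h, diff_comp_right]
  rfl

end Transversal

end TwoGroup

/-! ### Quadruples and gauge trivial representations -/

namespace TwoGroup

open TwoMatrix Mor2

universe v u

variable {G : Type u} [Category.{v} G] [MonoidalCategory G] [TwoGroup G] {n : ℕ}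
  {S : Transversal G} {α : Cochain.Cocycle3 (piAction G)}

theorem QuadrupleOfDim.d2_c (q : QuadrupleOfDim α n) (g h k : Pi0 G) :
    permAction n (q.ρ g) (q.c h k) * (q.c (g * h) k)⁻¹ * q.c g (h * k) * (q.c g h)⁻¹ =
      q.β (α.val g h k) :=
  congrFun (congrFun (congrFun q.coboundary g) h) k

/-- The scalars of the gauge trivial representation of a quadruple in which the chosen isomorphisms
from the objects to the representatives act trivially. A morphism then acts through its deviation
`dev`, and the structural 2-isomorphisms are those of the representatives, corrected by
`tensorDev`. -/
noncomputable def QuadrupleOfDim.toScalarRep (q : QuadrupleOfDim α n) (hα : IsClassifying S α) :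
    ScalarRep G n where
  ρ := q.ρ
  hom f := q.β (S.dev f)
  ten A B := q.c (cls A) (cls B) * (q.β (S.tensorDev A B))⁻¹
  unit := 1
  hom_comp f g := by rw [S.dev_comp, map_mul]
  hom_whiskerRight f B := by
    have h := congrArg q.β (S.dev_whiskerRight f B)
    rw [map_mul, map_mul] at h
    rw [cls_eq_of_hom f]
    apply Additive.ofMul.injective
    replace h := congrArg Additive.ofMul h
    simp only [ofMul_mul, ofMul_inv] at *
    grind
  hom_whiskerLeft A B B' f := by
    have h := congrArg q.β (S.dev_whiskerLeft A f)
    rw [map_mul, map_mul, q.map_smul] at h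
    rw [cls_eq_of_hom f]
    apply Additive.ofMul.injective
    replace h := congrArg Additive.ofMul h
    simp only [ofMul_mul, ofMul_inv] at *
    grind
  hom_associator_inv A B C := by
    have h := congrArg q.β (S.dev_associator_inv hα A B C)
    have h' := q.d2_c (cls A) (cls B) (cls C)
    simp only [map_mul, q.map_smul] at h
    have h1 : cls (A ⊗ B) = cls A * cls B := rfl
    have h2 : cls (B ⊗ C) = cls B * cls C := rfl
    rw [h1, h2, map_mul, map_inv]
    apply Additive.ofMul.injective
    replace h := congrArg Additive.ofMul h
    replace h' := congrArg Additive.ofMul h'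
    simp only [ofMul_mul, ofMul_inv] at *
    grind
  hom_leftUnitor A := by
    have h : q.c (cls (𝟙_ G)) (cls A) = 1 := (q.isNormalized _).1
    rw [S.dev_leftUnitor, h, one_mul, inv_inv, inv_one, mul_one]
  hom_rightUnitor A := by
    have h : q.c (cls A) (cls (𝟙_ G)) = 1 := (q.isNormalized _).2
    rw [S.dev_rightUnitor, h, one_mul, inv_inv, map_one, inv_one, mul_one]

namespace ScalarRep

theorem hom_eqToHom (D : ScalarRep G n) {A B : G} (h : A = B) : D.hom (eqToHom h) = 1 := by
  subst h; exact D.hom_id A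

theorem hom_iso_inv (D : ScalarRep G n) {A B : G} (f : A ≅ B) : D.hom f.inv = (D.hom f.hom)⁻¹ := by
  rw [eq_inv_iff_mul_eq_one, ← D.hom_comp, f.inv_hom_id, D.hom_id]

theorem hom_gamma (D : ScalarRep G n) (A : G) (u : Pi1 G) :
    D.hom (gamma A u).hom = D.hom u.hom := by
  rw [gamma_hom, D.hom_comp, D.hom_comp, D.hom_iso_inv, D.hom_whiskerRight,
    mul_comm (D.hom u.hom), inv_mul_cancel_left, mul_comm, mul_inv_cancel_right]

theorem hom_delta (D : ScalarRep G n) (A : G) (u : Pi1 G) :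
    D.hom (delta A u).hom = permAction n (D.ρ (cls A)) (D.hom u.hom) := by
  rw [delta_hom, D.hom_comp, D.hom_comp, D.hom_iso_inv, D.hom_whiskerLeft,
    mul_comm (permAction n (D.ρ (cls A)) (D.hom u.hom)), inv_mul_cancel_left, mul_comm,
    mul_inv_cancel_right]

theorem hom_diff (D : ScalarRep G n) {A B : G} (f f' : A ⟶ B) :
    D.hom (diff f f').hom * D.hom f' = D.hom f := by
  rw [← D.hom_gamma A, ← D.hom_comp, gamma_diff]

/-- The scalars `D` restrict to the quadruple `q` on the chosen representatives, once the action of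
the unit object is made strict: `D.unit` need not be trivial. -/
structure Matches (D : ScalarRep G n) (S : Transversal G) (q : QuadrupleOfDim α n) : Prop where
  ρ : q.ρ = D.ρ
  β (u : Pi1 G) : q.β u = D.hom u.hom
  c (g h : Pi0 G) : q.c g h = D.ten (S.obj g) (S.obj h) * permAction n (D.ρ g) D.unit *
    D.hom (S.mu g h).hom

theorem matches_toScalarRep (q : QuadrupleOfDim α n) (hα : IsClassifying S α) :
    (q.toScalarRep hα).Matches S q where
  ρ := rfl
  β u := by
    -- The unit object is its own representative, so `toObj` is the identity there.
    have : S.dev u.hom = u := by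
      apply diff_eq
      rw [gamma_unit, eqToHom_refl, Category.comp_id]
    exact (congrArg q.β this).symm
  c g h := by
    have h1 : S.dev (S.mu g h).hom = S.tensorDev (S.obj g) (S.obj h) := by
      have e : S.obj (cls (S.obj g) * cls (S.obj h)) = S.obj (cls (S.obj (g * h))) := by
        rw [S.cls_obj, S.cls_obj, S.cls_obj]
      have h2 : S.dev (S.mu g h).hom = diff ((S.mu g h).hom ≫ (S.toObj (S.obj (g * h))).hom)
        (S.toObjTensor (S.obj g) (S.obj h) ≫ eqToHom e) := rfl
      rw [h2, S.toObj_hom (by rw [S.cls_obj]), Transversal.tensorDev,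
        ← diff_comp_right _ _ (eqToHom e)]
      congr 1
      rw [Transversal.tensorToObj, S.toObj_hom (by rw [S.cls_obj]), S.toObj_hom (by rw [S.cls_obj])]
      simp only [Category.assoc]
      have h3 := S.eqToHom_mu (S.cls_obj g).symm (S.cls_obj h).symm
      rw [← reassoc_of% h3, eqToHom_trans]
    change q.c g h = q.c (cls (S.obj g)) (cls (S.obj h)) * _⁻¹ * permAction n (q.ρ g) 1 * q.β _
    rw [h1, S.cls_obj, S.cls_obj, map_one, mul_one, inv_mul_cancel_right]

/-- All scalars restrict to a quadruple. -/
theorem exists_matches (D : ScalarRep G n) (hα : IsClassifying S α) :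
    ∃ q : QuadrupleOfDim α n, D.Matches S q := by
  let β : Pi1 G →* (Fin n → ℂˣ) := MonoidHom.mk' (fun u => D.hom u.hom) fun u v => by
    rw [mul_hom, D.hom_comp, mul_comm]
  have hβ : ∀ (g : Pi0 G) (u : Pi1 G), β (g • u) = permAction n (D.ρ g) (β u) := by
    rintro ⟨A⟩ u
    change D.hom (act A u).hom = permAction n (D.ρ (cls A)) (D.hom u.hom)
    rw [← D.hom_gamma A, gamma_act, D.hom_delta]
  -- The factor `D.unit`, which is trivial if `D` is strictly unital, normalizes the cochain.
  let c : Pi0 G → Pi0 G → Fin n → ℂˣ := fun g h => D.ten (S.obj g) (S.obj h) *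
    permAction n (D.ρ g) D.unit * D.hom (S.mu g h).hom
  have hc : Cochain.d2 ((permAction n).comp D.ρ) c = fun g h k => β (α.val g h k) := by
    funext g h k
    -- The defining equation of the classifying cocycle, to which `D.hom` is applied.
    have h1 : (α_ (S.obj g) (S.obj h) (S.obj k)).inv ≫ (S.mu g h).hom ▷ S.obj k ≫
        (S.mu (g * h) k).hom ≫ (gamma (S.obj _) (α.val g h k)).hom =
        S.obj g ◁ (S.mu h k).hom ≫ (S.mu g (h * k)).hom ≫ eqToHom (by rw [mul_assoc]) := by
      rw [hα, Transversal.assoc]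
      simp
    replace h1 := congrArg D.hom h1
    simp only [D.hom_comp, D.hom_associator_inv, D.hom_whiskerRight, D.hom_whiskerLeft,
      D.hom_eqToHom, D.hom_gamma, S.cls_obj] at h1
    change permAction n (D.ρ g) (D.ten (S.obj h) (S.obj k) * permAction n (D.ρ h) D.unit *
        D.hom (S.mu h k).hom) *
      (D.ten (S.obj (g * h)) (S.obj k) * permAction n (D.ρ (g * h)) D.unit *
        D.hom (S.mu (g * h) k).hom)⁻¹ *
      (D.ten (S.obj g) (S.obj (h * k)) * permAction n (D.ρ g) D.unit *
        D.hom (S.mu g (h * k)).hom) *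
      (D.ten (S.obj g) (S.obj h) * permAction n (D.ρ g) D.unit * D.hom (S.mu g h).hom)⁻¹ =
      D.hom (α.val g h k).hom
    have h2 : permAction n (D.ρ (g * h)) D.unit =
        permAction n (D.ρ g) (permAction n (D.ρ h) D.unit) := by
      rw [map_mul, map_mul, MulAut.mul_apply]
    rw [h2, map_mul, map_mul]
    apply Additive.ofMul.injective
    replace h1 := congrArg Additive.ofMul h1
    simp only [ofMul_mul, ofMul_inv, ofMul_one] at *
    grind
  refine ⟨⟨D.ρ, β, hβ, ⟨c, hc⟩, c, fun g => ⟨?_, ?_⟩, hc⟩, rfl, fun _ => rfl, fun _ _ => rfl⟩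
  · change D.ten (S.obj 1) (S.obj g) * permAction n (D.ρ 1) D.unit * D.hom (S.mu 1 g).hom = 1
    rw [S.mu_one_left, D.hom_comp, D.hom_comp, D.hom_eqToHom, D.hom_eqToHom, D.hom_leftUnitor,
      S.obj_one, map_one, map_one, MulAut.one_apply, one_mul, mul_one, ← mul_inv, mul_inv_cancel]
  · change D.ten (S.obj g) (S.obj 1) * permAction n (D.ρ g) D.unit * D.hom (S.mu g 1).hom = 1
    rw [S.mu_one_right, D.hom_comp, D.hom_comp, D.hom_eqToHom, D.hom_eqToHom, D.hom_rightUnitor,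
      S.obj_one, S.cls_obj, one_mul, mul_one, ← mul_inv, mul_inv_cancel]

/-- The scalars of a representation are determined by the quadruple up to a change of bases: the
chosen isomorphisms from the objects to the representatives provide the bases. -/
theorem Matches.isGauge {D : ScalarRep G n} {q : QuadrupleOfDim α n} (h : D.Matches S q)
    (hα : IsClassifying S α) :
    D.IsGauge (q.toScalarRep hα) fun A => D.unit⁻¹ * D.hom (S.toObj A).hom where
  ρ := h.ρ
  hom {A B} f := by
    change D.hom f * (D.unit⁻¹ * _) = _ * q.β (S.dev f)
    have h1 := D.hom_diff (f ≫ (S.toObj B).hom)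
      ((S.toObj A).hom ≫ eqToHom (by rw [cls_eq_of_hom f]))
    rw [D.hom_comp, D.hom_comp, D.hom_eqToHom, mul_one] at h1
    rw [h.β, Transversal.dev, mul_left_comm, ← h1, mul_assoc, mul_comm (D.hom (Iso.hom _))]
  ten A B := by
    change _ * (q.c (cls A) (cls B) * (q.β (S.tensorDev A B))⁻¹)⁻¹ = _
    have h1 := D.hom_diff (S.tensorToObj A B) (S.toObjTensor A B)
    have h2 : D.hom (S.toObjTensor A B) = D.hom (S.toObj (A ⊗ B)).hom := rfl
    rw [Transversal.tensorToObj, D.hom_comp, D.hom_comp, D.hom_whiskerRight,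
      D.hom_whiskerLeft, S.cls_obj, h2] at h1
    rw [h.β, h.c, map_mul, map_inv, Transversal.tensorDev, Transversal.tensorToObj]
    apply Additive.ofMul.injective
    replace h1 := congrArg Additive.ofMul h1
    simp only [ofMul_mul, ofMul_inv] at *
    grind
  unit := by
    change D.unit⁻¹ * D.hom (S.toObj (𝟙_ G)).hom * 1⁻¹ = _
    rw [S.toObj_hom S.obj_one.symm, D.hom_eqToHom, inv_one, mul_one, mul_one]

end ScalarRep

namespace RepData.Models

variable {R : RepData G n} {D : ScalarRep G n}

theorem scal_tensor_mu (h : R.Models D) (g k : Pi0 G) :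
    scal ((R.ten (S.obj g) (S.obj k)).hom ≫ R.hom (S.mu g k).hom) =
      monomial (D.ten (S.obj g) (S.obj k) * D.hom (S.mu g k).hom) (D.ρ (g * k)) := by
  have : ∀ A, (R.obj A).HasPermRank := fun A => (h.obj A).hasPermRank
  rw [scal_comp, h.ten, h.hom, map_cls_tensor, S.cls_obj, S.cls_obj, monomial_hadamard, map_mul]

theorem obj_rep (h : R.Models D) (S : Transversal G) (g : Pi0 G) :
    (R.obj (S.obj g)).IsPerm (D.ρ g) := by
  have := h.obj (S.obj g)
  rwa [S.cls_obj] at this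

theorem obj_tensor (h : R.Models D) (S : Transversal G) (g k : Pi0 G) :
    (Mor.comp (R.obj (S.obj g)) (R.obj (S.obj k))).IsPerm (D.ρ (g * k)) := by
  rw [map_mul]
  exact (h.obj_rep S g).comp (h.obj_rep S k)

theorem scal_gamma (h : R.Models D) (S : Transversal G) (g : Pi0 G) (u : Pi1 G) :
    scal (R.hom (gamma (S.obj g) u).hom) = monomial (D.hom u.hom) (D.ρ g) := by
  rw [h.hom, D.hom_gamma, S.cls_obj]

/-- A representation by permutation matrices with trivial gauges is a gauge trivial representation
of the quadruple of its scalars, if it is strictly unital. -/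
theorem isGaugeTrivial (h : R.Models D) {q : QuadrupleOfDim α n} (hq : D.Matches S q)
    (hobj : ∀ g, R.obj (S.obj g) = Mor.perm (D.ρ g)) (hunit : D.unit = 1) :
    Representation.IsGaugeTrivial S R.toRep q where
  obj g := by rw [hq.ρ]; exact hobj g
  hom g u j x y := by
    have h1 := h.obj_rep S g
    have h2 := h.scal_gamma S g u
    rw [← hq.ρ] at h1 h2
    rw [← hq.β] at h2
    exact entry_of_scal h1 h1 h2 j x y
  tensor g k j x y := by
    have h1 := h.obj_tensor S g k
    have h2 := h.obj_rep S (g * k)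
    have h3 := h.scal_tensor_mu (S := S) g k
    have h4 := hq.c g k
    rw [hunit, map_one, mul_one] at h4
    rw [← hq.ρ] at h1 h2 h3
    rw [← h4] at h3
    exact entry_of_scal h1 h2 h3 j x y
  unit j x y := by
    have h1 := h.unit
    rw [hunit] at h1
    have h2 := h.obj (𝟙_ G)
    rw [map_cls_unit] at h2
    exact (entry_of_scal Mor.isPerm_one h2 h1 j x y).trans (by simp)

/-- The scalars of a gauge trivial representation restrict to its quadruple. -/
theorem matches_of_isGaugeTrivial (h : R.Models D) {q : QuadrupleOfDim α n}
    (hR : Representation.IsGaugeTrivial S R.toRep q) : D.Matches S q := by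
  have hρ : q.ρ = D.ρ := by
    ext1 g
    have h1 : (R.obj (S.obj g)).IsPerm (q.ρ g) := by
      have h2 : R.obj (S.obj g) = Mor.perm (q.ρ g) := hR.obj g
      rw [h2]
      exact Mor.isPerm_perm _
    exact (monomial_injective (h1.rankC.symm.trans (h.obj_rep S g).rankC)).2
  have hu : D.unit = 1 := by
    have h2 := h.obj (𝟙_ G)
    rw [map_cls_unit] at h2
    have h1 := scal_of_entry (x := 1) Mor.isPerm_one h2 (T := R.unit.hom) fun j p r =>
      (hR.unit j p r).trans (by simp)
    exact (monomial_injective (h.unit.symm.trans h1)).1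
  refine ⟨hρ, fun u => ?_, fun g k => ?_⟩
  · have h1 := scal_of_entry (x := q.β u) (h.obj_rep S 1) (h.obj_rep S 1)
      (T := R.hom (gamma (S.obj 1) u).hom) fun j p r => by
        have := hR.hom 1 u j
        rw [hρ] at this
        exact this p r
    exact (monomial_injective (h1.symm.trans (h.scal_gamma S 1 u))).1
  · have h1 := scal_of_entry (x := q.c g k) (h.obj_tensor S g k) (h.obj_rep S (g * k))
      (T := (R.ten (S.obj g) (S.obj k)).hom ≫ R.hom (S.mu g k).hom) fun j p r => by
        have := hR.tensor g k j
        rw [hρ] at this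
        exact this p r
    rw [hu, map_one, mul_one]
    exact (monomial_injective (h1.symm.trans (h.scal_tensor_mu g k))).1

end RepData.Models

/-- The gauge trivial representation of a quadruple. -/
theorem QuadrupleOfDim.isGaugeTrivial_toRep (q : QuadrupleOfDim α n) (hα : IsClassifying S α) :
    Representation.IsGaugeTrivial S (q.toScalarRep hα).toRepData.toRep q :=
  (ScalarRep.models_toRepData _).isGaugeTrivial (ScalarRep.matches_toScalarRep q hα)
    (fun g => by
      change Mor.perm (q.ρ (cls (S.obj g))) = Mor.perm (q.ρ g)
      rw [S.cls_obj]) rfl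

/-- Gauge trivial representations come from scalars that restrict to the quadruple. -/
theorem Representation.Realizes.exists_models {q : Quadruple α} {F : Representation G}
    (hF : F.Realizes S q) : ∃ (R : RepData G q.n) (D : ScalarRep G q.n),
      R.toRep = F ∧ R.Models D ∧ D.Matches S q.data := by
  obtain ⟨n, hn, q⟩ := q
  obtain ⟨e, hF⟩ := hF
  change n = F.dim at e
  subst e
  obtain ⟨D, hD⟩ := (RepData.ofRep F).exists_models
  exact ⟨RepData.ofRep F, D, rfl, hD, hD.matches_of_isGaugeTrivial hF⟩

end TwoGroup

theorem mainTheorem5 {G : Type*} [CategoryTheory.Category G]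
    [CategoryTheory.MonoidalCategory G] [TwoGroup G]
    (S : TwoGroup.Transversal G) (α : Cochain.Cocycle3 (TwoGroup.piAction G))
    (hα : TwoGroup.IsClassifying S α) :
    (∀ F : TwoGroup.Representation G, 1 ≤ F.dim →
      ∃ q : TwoGroup.Quadruple α, q.n = F.dim ∧
        ∃ F₀ : TwoGroup.Representation G, F₀.Realizes S q ∧ F.Isomorphic F₀) ∧
    (∀ q : TwoGroup.Quadruple α, ∃ F₀ : TwoGroup.Representation G,
      1 ≤ F₀.dim ∧ F₀.Realizes S q) ∧
    (∀ (q : TwoGroup.Quadruple α) (F₀ F₁ : TwoGroup.Representation G),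
      F₀.Realizes S q → F₁.Realizes S q → F₀.Isomorphic F₁) := by
  refine ⟨fun F hF => ?_, fun q => ?_, fun q F₀ F₁ h₀ h₁ => ?_⟩
  · obtain ⟨D, hD⟩ := (TwoGroup.RepData.ofRep F).exists_models
    obtain ⟨q, hq⟩ := D.exists_matches (S := S) hα
    exact ⟨⟨F.dim, hF, q⟩, rfl, (q.toScalarRep hα).toRepData.toRep,
      ⟨rfl, q.isGaugeTrivial_toRep hα⟩,
      hD.isomorphic (TwoGroup.ScalarRep.models_toRepData _) (hq.isGauge hα)⟩
  · exact ⟨(q.data.toScalarRep hα).toRepData.toRep, q.one_le, rfl,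
      q.data.isGaugeTrivial_toRep hα⟩
  · obtain ⟨R₀, D₀, rfl, hD₀, hq₀⟩ := h₀.exists_models
    obtain ⟨R₁, D₁, rfl, hD₁, hq₁⟩ := h₁.exists_models
    exact hD₀.isomorphic hD₁ ((hq₀.isGauge hα).trans (hq₁.isGauge hα).symm)
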